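/- Let $p$ be a prime. All subgroups of profinite groups are taken to be closed and all homomorphisms continuous. A *fusion system* on a finite $p$-group $S$ is a category whose objects are the subgroups of $S$ and whose morphisms are injective group homomorphisms, which contains every homomorphism between subgroups induced by conjugation by an element of $S$, and in which every morphism is an isomorphism of the category followed by an inclusion. It is *saturated* if every isomorphism class of objects contains a fully normalized subgroup $Q$, that is: (i) (receptivity) every isomorphism $\varphi:R\to Q$ in the system extends to a morphism $N_\varphi\to N_S(Q)$ in the system, where $N_\varphi=\{x\in N_S(R)\mid \exists y\in N_S(Q)\ \forall u\in R:\ \varphi(xux^{-1})=y\varphi(u)y^{-1}\}$; and (ii) the automorphisms of $Q$ induced by conjugation by elements of $N_S(Q)$ form a Sylow $p$-subgroup of $\mathrm{Aut}_{\mathcal F}(Q)$. A *morphism* from a system $\mathcal F$ on $S$ to a system $\mathcal G$ on $T$ is a homomorphism $\alpha:S\to T$ such that for each $\varphi\in\mathrm{Hom}_{\mathcal F}(P,Q)$ there is $A(\varphi)\in\mathrm{Hom}_{\mathcal G}(\alpha(P),\alpha(Q))$ with $A(\varphi)\alpha=\alpha\varphi$ on $P$. The *inverse limit* of an inverse system $(\mathcal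 F_i)_{i\in I}$ of fusion systems on finite $p$-groups $S_i$ ($I$ a directed partially ordered set, transition maps morphisms of fusion systems) is the category on the pro-$p$ group $S=\varprojlim S_i$, with projections $f_i:S\to S_i$, whose objects are the closed subgroups of $S$, with $\mathrm{Hom}(P,Q)=\varprojlim_i\mathrm{Hom}_{\mathcal F_i}(f_i(P),f_i(Q))$, regarded as a set of continuous homomorphisms $P\to Q$. Morphisms and isomorphisms between such limits are defined as for fusion systems. A *pro-saturated fusion system* $\mathcal F$ on a pro-$p$ group $S$ is one that is isomorphic to an inverse limit of saturated fusion systems on finite $p$-groups. A subgroup $N\le S$ is *strongly $\mathcal F$-closed* if $R\le N$ implies $\varphi(R)\le N$ for all $\varphi\in\mathrm{Hom}_{\mathcal F}(R,S)$; such an $N$ is normal. If $N$ is also open, $\mathcal F/N$ is the fusion system on the finite group $S/N$ in which a homomorphism $\varphi:A\to B$ between subgroups of $S/N$ is a morphism if and only if there is $\tilde\varphi\in\mathrm{Hom}_{\mathcal F}(\tilde A,S)$, $\tilde A$ being the full preimage of $A$ in $S$, with $\varphi(uN)=\tilde\varphi(u)N$ for all $u\in\tilde A$. **Proposition.** Let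 $\mathcal F$ be a pro-saturated fusion system on a pro-$p$ group $S$. As $N$ runs through all open strongly $\mathcal F$-closed subgroups of $S$, ordered by reverse inclusion, the groups $S/N$ are finite $p$-groups, the natural maps $S/N\to S/M$ (for $N\le M$) are morphisms of fusion systems $\mathcal F/N\to\mathcal F/M$, so that the $\mathcal F/N$ form an inverse system, and the natural map $S\to\varprojlim_N S/N$ is an isomorphism $$\mathcal F\;\cong\;\varprojlim_{N}\mathcal F/N .$$ -/

import Mathlib

universe u v w

/-! ## Closed subgroups -/

namespace ClosedSubgroup

/-- The inclusion of a closed subgroup in a larger one. -/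
def inclusion {S : Type*} [Group S] [TopologicalSpace S] {P Q : ClosedSubgroup S} (h : P ≤ Q) :
    P →ₜ* Q where
  toFun x := ⟨x, h x.2⟩
  map_one' := rfl
  map_mul' _ _ := rfl
  continuous_toFun := continuous_subtype_val.subtype_mk _

/-- The whole group as a closed subgroup. -/
def whole (S : Type*) [Group S] [TopologicalSpace S] : ClosedSubgroup S :=
  ⟨⊤, isClosed_univ⟩

/-- In a discrete group every subgroup is closed. -/
def ofDiscrete {S : Type*} [Group S] [TopologicalSpace S] [DiscreteTopology S] (H : Subgroup S) :
    ClosedSubgroup S :=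
  ⟨H, isClosed_discrete _⟩

/-- The preimage of a closed subgroup under a continuous homomorphism. -/
def preimage {S T : Type*} [Group S] [TopologicalSpace S] [Group T] [TopologicalSpace T]
    (f : S →ₜ* T) (A : ClosedSubgroup T) : ClosedSubgroup S :=
  ⟨A.toSubgroup.comap f.toMonoidHom, A.isClosed'.preimage f.continuous_toFun⟩

/-- The image of a closed subgroup under a continuous homomorphism between compact Hausdorff
groups. -/
def image {S T : Type*} [Group S] [TopologicalSpace S] [CompactSpace S]
    [Group T] [TopologicalSpace T] [T2Space T] (f : S →ₜ* T) (P : ClosedSubgroup S) :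
    ClosedSubgroup T :=
  ⟨P.toSubgroup.map f.toMonoidHom, (P.isClosed'.isCompact.image f.continuous_toFun).isClosed⟩

/-- The image of an element of `P` in the image of `P`. -/
def toImage {S T : Type*} [Group S] [TopologicalSpace S] [CompactSpace S]
    [Group T] [TopologicalSpace T] [T2Space T] (f : S →ₜ* T) (P : ClosedSubgroup S) (x : P) :
    P.image f :=
  ⟨f x, x, x.2, rfl⟩

end ClosedSubgroup

/-! ## Fusion systems -/

/-- A category whose objects are the closed subgroups of a topological group `S`, whose morphisms
are continuous injective homomorphisms, which contains all homomorphisms induced by conjugation by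
an element of `S` (in particular all inclusions), and in which every morphism is an isomorphism of
the category followed by an inclusion.  When `S` is a finite `p`-group with the discrete topology
(so that all subgroups are closed and all homomorphisms are continuous) this is a fusion system
on `S`. -/
structure FusionSystem (S : Type u) [Group S] [TopologicalSpace S] where
  Hom (P Q : ClosedSubgroup S) : Set (P →ₜ* Q)
  injective : ∀ {P Q : ClosedSubgroup S} {φ : P →ₜ* Q}, φ ∈ Hom P Q → Function.Injective φ
  id_mem : ∀ P : ClosedSubgroup S, ContinuousMonoidHom.id P ∈ Hom P P
  comp_mem : ∀ {P Q R : ClosedSubgroup S} {φ : P →ₜ* Q} {ψ : Q →ₜ* R},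
    φ ∈ Hom P Q → ψ ∈ Hom Q R → ψ.comp φ ∈ Hom P R
  conj_mem : ∀ {P Q : ClosedSubgroup S} (φ : P →ₜ* Q) (s : S),
    (∀ x : P, (φ x : S) = s * x * s⁻¹) → φ ∈ Hom P Q
  factor : ∀ {P Q : ClosedSubgroup S} {φ : P →ₜ* Q}, φ ∈ Hom P Q →
    ∃ (R : ClosedSubgroup S) (hRQ : R ≤ Q), ∃ θ ∈ Hom P R, ∃ θ' ∈ Hom R P,
      (∀ x, θ' (θ x) = x) ∧ (∀ y, θ (θ' y) = y) ∧
        φ = (ClosedSubgroup.inclusion hRQ).comp θ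

namespace FusionSystem

section Basic

variable {S : Type u} [Group S] [TopologicalSpace S] (F : FusionSystem S)

theorem inclusion_mem {P Q : ClosedSubgroup S} (h : P ≤ Q) :
    ClosedSubgroup.inclusion h ∈ F.Hom P Q :=
  F.conj_mem _ 1 fun x => by
    change (x : S) = _
    simp

theorem hom_codRestrict {P Q : ClosedSubgroup S}
    {ψ : P →ₜ* ClosedSubgroup.whole S} (hψ : ψ ∈ F.Hom P (ClosedSubgroup.whole S))
    (h : ∀ x, (ψ x : S) ∈ Q) : ∃ χ ∈ F.Hom P Q, ∀ x, (χ x : S) = ψ x := by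
  obtain ⟨R, hR, θ, hθ, θ', hθ', h1, h2, rfl⟩ := F.factor hψ
  have hRQ : R ≤ Q := by
    intro r hr
    have := h (θ' ⟨r, hr⟩)
    change (θ (θ' ⟨r, hr⟩) : S) ∈ Q at this
    rwa [h2] at this
  exact ⟨_, F.comp_mem hθ (F.inclusion_mem hRQ), fun _ => rfl⟩

/-- A subgroup `Q` of `S` is strongly closed if every morphism of the system defined on a subgroup
of `Q` has its image in `Q`. -/
def IsStronglyClosed (Q : Subgroup S) : Prop :=
  ∀ (R : ClosedSubgroup S), ∀ φ ∈ F.Hom R (ClosedSubgroup.whole S),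
    R.toSubgroup ≤ Q → ∀ x : R, (φ x : S) ∈ Q

/-- `φ` is an isomorphism of the category. -/
def IsIso {P Q : ClosedSubgroup S} (φ : P →ₜ* Q) : Prop :=
  φ ∈ F.Hom P Q ∧ ∃ ψ ∈ F.Hom Q P, (∀ x, ψ (φ x) = x) ∧ ∀ y, φ (ψ y) = y

/-- The group of automorphisms of `Q` in the category. -/
def aut (Q : ClosedSubgroup S) : Subgroup (MulAut Q) where
  carrier := {α | (∃ φ ∈ F.Hom Q Q, ∀ x, φ x = α x) ∧ ∃ φ ∈ F.Hom Q Q, ∀ x, φ x = α⁻¹ x}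
  one_mem' := ⟨⟨_, F.id_mem Q, fun _ => rfl⟩, ⟨_, F.id_mem Q, fun _ => rfl⟩⟩
  mul_mem' := by
    rintro α β ⟨⟨φ, hφ, h1⟩, φ', hφ', h2⟩ ⟨⟨ψ, hψ, h3⟩, ψ', hψ', h4⟩
    refine ⟨⟨_, F.comp_mem hψ hφ, fun x => ?_⟩, _, F.comp_mem hφ' hψ', fun x => ?_⟩
    · change φ (ψ x) = α (β x)
      rw [h3, h1]
    · change ψ' (φ' x) = (α * β)⁻¹ x
      rw [h2, h4, mul_inv_rev]
      rfl
  inv_mem' := by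
    rintro α ⟨h, h'⟩
    exact ⟨h', by simpa using h⟩

/-- The subgroup of `F.aut Q` of the automorphisms induced by conjugation by elements of `S`
(which then normalize `Q`). -/
def autInner (Q : ClosedSubgroup S) : Subgroup (F.aut Q) where
  carrier := {α | ∃ s : S, ∀ x : Q, ((α : MulAut Q) x : S) = s * x * s⁻¹}
  one_mem' := ⟨1, by simp⟩
  mul_mem' := by
    rintro α β ⟨s, hs⟩ ⟨t, ht⟩
    refine ⟨s * t, fun x => ?_⟩
    change ((α : MulAut Q) ((β : MulAut Q) x) : S) = _
    rw [hs, ht]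
    group
  inv_mem' := by
    rintro α ⟨s, hs⟩
    refine ⟨s⁻¹, fun x => ?_⟩
    have h := hs ((α : MulAut Q)⁻¹ x)
    have h2 : (α : MulAut Q) ((α : MulAut Q)⁻¹ x) = x := MulAut.apply_inv_self Q _ x
    rw [h2] at h
    change (((α : MulAut Q)⁻¹ x : Q) : S) = _
    rw [h]
    group

/-- `N_φ`: the elements `x` of the normalizer of `R` for which there is `y` in the normalizer of
`Q` such that `φ (x u x⁻¹) = y φ(u) y⁻¹` for all `u` in `R`. -/
def extensionSubgroup {R Q : ClosedSubgroup S} (φ : R →ₜ* Q) : Subgroup S where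
  carrier := {x | x ∈ Subgroup.normalizer (R : Set S) ∧
    ∃ y ∈ Subgroup.normalizer (Q : Set S),
      ∀ u v : R, (v : S) = x * u * x⁻¹ → (φ v : S) = y * φ u * y⁻¹}
  one_mem' := by
    refine ⟨one_mem _, 1, one_mem _, fun u v h => ?_⟩
    have : v = u := Subtype.ext (by simpa using h)
    simp [this]
  mul_mem' := by
    rintro a b ⟨ha, y, hy, h1⟩ ⟨hb, z, hz, h2⟩
    refine ⟨mul_mem ha hb, y * z, mul_mem hy hz, fun u v h => ?_⟩
    have hm : b * u * b⁻¹ ∈ R := (Subgroup.mem_normalizer_iff.1 hb u).1 u.2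
    rw [h1 ⟨_, hm⟩ v (by rw [h]; group), h2 u ⟨_, hm⟩ rfl]
    group
  inv_mem' := by
    rintro a ⟨ha, y, hy, h1⟩
    refine ⟨inv_mem ha, y⁻¹, inv_mem hy, fun u v h => ?_⟩
    rw [h1 v u (by rw [h]; group)]
    group

end Basic

section Saturation

variable {S : Type u} [Group S] [TopologicalSpace S] [DiscreteTopology S] (F : FusionSystem S)

/-- `Q` is receptive if every isomorphism `φ : R → Q` of the system extends to a morphism
`N_φ → N_S(Q)` of the system. -/
def IsReceptive (Q : ClosedSubgroup S) : Prop :=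
  ∀ (R : ClosedSubgroup S) (φ : R →ₜ* Q), F.IsIso φ →
    ∃ ψ ∈ F.Hom (ClosedSubgroup.ofDiscrete (extensionSubgroup φ))
        (ClosedSubgroup.ofDiscrete (Subgroup.normalizer (Q : Set S))),
      ∀ (x : R) (y : ClosedSubgroup.ofDiscrete (extensionSubgroup φ)),
        (y : S) = x → (ψ y : S) = φ x

/-- `Q` is fully normalized if it is receptive and the automorphisms of `Q` induced by conjugation
in `S` form a Sylow `p`-subgroup of the automorphism group of `Q` in the system. -/
def IsFullyNormalized (p : ℕ) (Q : ClosedSubgroup S) : Prop :=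
  F.IsReceptive Q ∧ ∃ P : Sylow p (F.aut Q), (P : Subgroup (F.aut Q)) = F.autInner Q

/-- A fusion system on a finite `p`-group is saturated if every isomorphism class of the category
contains a fully normalized subgroup. -/
def IsSaturated (p : ℕ) : Prop :=
  ∀ P : ClosedSubgroup S, ∃ (Q : ClosedSubgroup S) (φ : P →ₜ* Q),
    F.IsIso φ ∧ F.IsFullyNormalized p Q

end Saturation

section Morphisms

variable {S : Type u} [Group S] [TopologicalSpace S] [CompactSpace S] [T2Space S]
  {T : Type v} [Group T] [TopologicalSpace T] [CompactSpace T] [T2Space T]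

/-- `α : S → T` is a morphism from `F` to `G`: for every morphism `φ : P → Q` of `F` there is a
(necessarily unique) morphism `A(φ) : α(P) → α(Q)` of `G` with `A(φ) ∘ α = α ∘ φ`.  By uniqueness
`A` is automatically a functor. -/
def IsMorphism (F : FusionSystem S) (G : FusionSystem T) (α : S →ₜ* T) : Prop :=
  ∀ (P Q : ClosedSubgroup S), ∀ φ ∈ F.Hom P Q, ∃ ψ ∈ G.Hom (P.image α) (Q.image α),
    ∀ x : P, ψ (P.toImage α x) = Q.toImage α (φ x)

/-- An isomorphism of (pro-)fusion systems: an isomorphism of topological groups that is a morphism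
in both directions. -/
structure Iso (F : FusionSystem S) (G : FusionSystem T) where
  toEquiv : S ≃ₜ* T
  isMorphism : F.IsMorphism G (toEquiv : S →ₜ* T)
  isMorphism_symm : G.IsMorphism F (toEquiv.symm : T →ₜ* S)

end Morphisms

end FusionSystem

/-! ## Inverse limits -/

/-- An inverse system of fusion systems on finite (discrete) groups `G i`, indexed by a partially
ordered set. -/
structure FusionInverseSystem (I : Type v) [PartialOrder I] (G : I → Type w)
    [∀ i, Group (G i)] [∀ i, TopologicalSpace (G i)] [∀ i, DiscreteTopology (G i)]
    [∀ i, Finite (G i)] where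
  sys : ∀ i, FusionSystem (G i)
  map : ∀ {i j : I}, i ≤ j → (G j →ₜ* G i)
  map_self : ∀ (i : I) (x : G i), map (le_refl i) x = x
  map_map : ∀ {i j k : I} (hij : i ≤ j) (hjk : j ≤ k) (x : G k),
    map hij (map hjk x) = map (hij.trans hjk) x
  isMorphism : ∀ {i j : I} (h : i ≤ j), (sys j).IsMorphism (sys i) (map h)

namespace FusionInverseSystem

variable {I : Type v} [PartialOrder I] {G : I → Type w}
  [∀ i, Group (G i)] [∀ i, TopologicalSpace (G i)] [∀ i, DiscreteTopology (G i)]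
  [∀ i, Finite (G i)] (D : FusionInverseSystem I G)

/-- The inverse limit of the groups, as a subgroup of their product. -/
def limitSubgroup : Subgroup (∀ i, G i) where
  carrier := {x | ∀ (i j : I) (h : i ≤ j), D.map h (x j) = x i}
  one_mem' := by intro i j h; simp
  mul_mem' := by
    intro a b ha hb i j h
    simp [ha i j h, hb i j h]
  inv_mem' := by
    intro a ha i j h
    simp [ha i j h]

/-- The inverse limit of the groups, with the topology induced from the product topology. -/
abbrev LimitGroup : Type (max v w) := D.limitSubgroup

theorem isClosed_limitSubgroup : IsClosed (D.limitSubgroup : Set (∀ i, G i)) := by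
  have : (D.limitSubgroup : Set (∀ i, G i)) =
      ⋂ (i : I) (j : I) (h : i ≤ j), {x | D.map h (x j) = x i} := by
    ext x
    simp [limitSubgroup]
  rw [this]
  refine isClosed_iInter fun i => isClosed_iInter fun j => isClosed_iInter fun h => ?_
  exact isClosed_eq ((D.map h).continuous_toFun.comp (continuous_apply j)) (continuous_apply i)

instance : CompactSpace D.LimitGroup :=
  isCompact_iff_compactSpace.1 D.isClosed_limitSubgroup.isCompact

/-- The projections of the inverse limit. -/
def proj (i : I) : D.LimitGroup →ₜ* G i where
  toFun x := (x : ∀ i, G i) i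
  map_one' := rfl
  map_mul' _ _ := rfl
  continuous_toFun := (continuous_apply i).comp continuous_subtype_val

/-- The morphisms of the inverse limit: the set `lim Hom (f_i(P), f_i(Q))`, with a compatible
family `(φ_i)` regarded as the unique continuous homomorphism `φ : P → Q` that induces every
`φ_i`, that is, `f_i ∘ φ = φ_i ∘ f_i`. -/
def limitHom (P Q : ClosedSubgroup D.LimitGroup) : Set (P →ₜ* Q) :=
  {φ | ∀ i, ∃ ψ ∈ (D.sys i).Hom (P.image (D.proj i)) (Q.image (D.proj i)),
    ∀ x : P, ψ (P.toImage (D.proj i) x) = Q.toImage (D.proj i) (φ x)}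

theorem limit_ext {x y : D.LimitGroup} (h : ∀ i, D.proj i x = D.proj i y) : x = y :=
  Subtype.ext (funext h)

theorem limitHom_injective {P Q : ClosedSubgroup D.LimitGroup} {φ : P →ₜ* Q}
    (hφ : φ ∈ D.limitHom P Q) : Function.Injective φ := by
  intro x y hxy
  refine Subtype.ext (D.limit_ext fun i => ?_)
  obtain ⟨ψ, hψ, h⟩ := hφ i
  have := (D.sys i).injective hψ (by rw [h x, h y, hxy] :
    ψ (P.toImage (D.proj i) x) = ψ (P.toImage (D.proj i) y))
  exact congrArg Subtype.val this

theorem limitHom_factor {P Q : ClosedSubgroup D.LimitGroup} {φ : P →ₜ* Q}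
    (hφ : φ ∈ D.limitHom P Q) :
    ∃ (R : ClosedSubgroup D.LimitGroup) (hRQ : R ≤ Q), ∃ θ ∈ D.limitHom P R,
      ∃ θ' ∈ D.limitHom R P, (∀ x, θ' (θ x) = x) ∧ (∀ y, θ (θ' y) = y) ∧
        φ = (ClosedSubgroup.inclusion hRQ).comp θ := by
  have hinj := D.limitHom_injective hφ
  have hcont : Continuous fun x : P => (φ x : D.LimitGroup) :=
    continuous_subtype_val.comp φ.continuous_toFun
  let ρ : P →* D.LimitGroup := (Q.toSubgroup.subtype).comp φ.toMonoidHom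
  let R : ClosedSubgroup D.LimitGroup := ⟨ρ.range, (isCompact_range hcont).isClosed⟩
  have hRQ : R ≤ Q := by
    rintro _ ⟨x, rfl⟩
    exact (φ x).2
  let θ : P →ₜ* R :=
    { toFun := fun x => ⟨φ x, x, rfl⟩
      map_one' := Subtype.ext (by simp)
      map_mul' := fun x y => Subtype.ext (by simp)
      continuous_toFun := hcont.subtype_mk _ }
  have hθb : Function.Bijective θ := by
    constructor
    · intro x y h
      exact hinj (Subtype.ext (congrArg (fun z : R => (z : D.LimitGroup)) h))
    · rintro ⟨_, x, rfl⟩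
      exact ⟨x, rfl⟩
  let e : P ≃* R := MulEquiv.ofBijective θ hθb
  have he : Continuous e.symm :=
    Continuous.continuous_symm_of_equiv_compact_to_t2 (f := e.toEquiv) θ.continuous_toFun
  let θ' : R →ₜ* P := { e.symm.toMonoidHom with continuous_toFun := he }
  have h1 : ∀ x, θ' (θ x) = x := fun x => e.symm_apply_apply x
  have h2 : ∀ y, θ (θ' y) = y := fun y => e.apply_symm_apply y
  have key : ∀ i, (∃ ψ ∈ (D.sys i).Hom (P.image (D.proj i)) (R.image (D.proj i)),
      ∀ x : P, ψ (P.toImage (D.proj i) x) = R.toImage (D.proj i) (θ x)) ∧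
      ∃ ψ ∈ (D.sys i).Hom (R.image (D.proj i)) (P.image (D.proj i)),
      ∀ x : R, ψ (R.toImage (D.proj i) x) = P.toImage (D.proj i) (θ' x) := by
    intro i
    obtain ⟨ψ, hψ, h⟩ := hφ i
    obtain ⟨A, hAQ, τ, hτ, τ', hτ', k1, k2, k3⟩ := (D.sys i).factor hψ
    have hval : ∀ x : P, (τ (P.toImage (D.proj i) x) : G i) = D.proj i (φ x) := by
      intro x
      have := h x
      rw [k3] at this
      exact congrArg Subtype.val this
    have hAR : A ≤ R.image (D.proj i) := by
      intro a ha
      obtain ⟨x, hx, hxb⟩ := (τ' ⟨a, ha⟩).2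
      have h3 : P.toImage (D.proj i) ⟨x, hx⟩ = τ' ⟨a, ha⟩ := Subtype.ext hxb
      have h4 := hval ⟨x, hx⟩
      rw [h3, k2] at h4
      exact ⟨φ ⟨x, hx⟩, ⟨⟨x, hx⟩, rfl⟩, h4.symm⟩
    have hRA : R.image (D.proj i) ≤ A := by
      rintro _ ⟨_, ⟨x, rfl⟩, rfl⟩
      have := (τ (P.toImage (D.proj i) x)).2
      rw [hval] at this
      exact this
    refine ⟨⟨_, (D.sys i).comp_mem hτ ((D.sys i).inclusion_mem hAR), fun x => ?_⟩,
      _, (D.sys i).comp_mem ((D.sys i).inclusion_mem hRA) hτ', fun y => ?_⟩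
    · exact Subtype.ext (hval x)
    · have : ClosedSubgroup.inclusion hRA (R.toImage (D.proj i) y) =
          τ (P.toImage (D.proj i) (θ' y)) := by
        refine Subtype.ext ?_
        rw [hval]
        change D.proj i (y : D.LimitGroup) = D.proj i ((θ (θ' y) : R) : D.LimitGroup)
        rw [h2]
      change τ' (ClosedSubgroup.inclusion hRA (R.toImage (D.proj i) y)) = _
      rw [this, k1]
  exact ⟨R, hRQ, θ, fun i => (key i).1, θ', fun i => (key i).2, h1, h2, rfl⟩

/-- The inverse limit of the fusion systems, on the inverse limit of the groups. -/
def limit : FusionSystem D.LimitGroup where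
  Hom := D.limitHom
  injective := D.limitHom_injective
  id_mem P i := ⟨_, (D.sys i).id_mem _, fun _ => rfl⟩
  comp_mem := by
    intro P Q R φ ψ hφ hψ i
    obtain ⟨α, hα, h1⟩ := hφ i
    obtain ⟨β, hβ, h2⟩ := hψ i
    refine ⟨_, (D.sys i).comp_mem hα hβ, fun x => ?_⟩
    change β (α _) = _
    rw [h1, h2]
    rfl
  conj_mem := by
    intro P Q φ s hs i
    have hm : ∀ y : P.image (D.proj i),
        D.proj i s * y * (D.proj i s)⁻¹ ∈ Q.image (D.proj i) := by
      rintro ⟨_, x, hx, rfl⟩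
      refine ⟨φ ⟨x, hx⟩, (φ ⟨x, hx⟩).2, ?_⟩
      change D.proj i (φ ⟨x, hx⟩) = _
      rw [hs, map_mul, map_mul, map_inv]
      rfl
    refine ⟨⟨⟨⟨fun y => ⟨_, hm y⟩, Subtype.ext (by simp)⟩,
      fun a b => Subtype.ext (by simp)⟩, continuous_of_discreteTopology⟩,
      (D.sys i).conj_mem _ (D.proj i s) fun _ => rfl, fun x => Subtype.ext ?_⟩
    change D.proj i s * D.proj i x * (D.proj i s)⁻¹ = D.proj i (φ x)
    rw [hs, map_mul, map_mul, map_inv]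
  factor := D.limitHom_factor

end FusionInverseSystem

/-! ## Pro-fusion systems -/

namespace FusionSystem

section Pro

variable {S : Type u} [Group S] [TopologicalSpace S] [CompactSpace S] [T2Space S]

/-- A pro-fusion system (for the prime `p`): `F` is isomorphic to the inverse limit of an inverse
system of fusion systems on finite `p`-groups, indexed by a directed set. -/
def IsProFusion (p : ℕ) (F : FusionSystem S) : Prop :=
  ∃ (I : Type v) (_ : PartialOrder I) (_ : IsDirectedOrder I) (G : I → Type w)
    (_ : ∀ i, Group (G i)) (_ : ∀ i, TopologicalSpace (G i)) (_ : ∀ i, DiscreteTopology (G i))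
    (_ : ∀ i, Finite (G i)) (D : FusionInverseSystem I G),
    (∀ i, IsPGroup p (G i)) ∧ Nonempty (F.Iso D.limit)

/-- A pro-saturated fusion system: `F` is isomorphic to the inverse limit of an inverse system of
saturated fusion systems on finite `p`-groups, indexed by a directed set. -/
def IsProSaturated (p : ℕ) (F : FusionSystem S) : Prop :=
  ∃ (I : Type v) (_ : PartialOrder I) (_ : IsDirectedOrder I) (G : I → Type w)
    (_ : ∀ i, Group (G i)) (_ : ∀ i, TopologicalSpace (G i)) (_ : ∀ i, DiscreteTopology (G i))
    (_ : ∀ i, Finite (G i)) (D : FusionInverseSystem I G),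
    (∀ i, IsPGroup p (G i)) ∧ (∀ i, (D.sys i).IsSaturated p) ∧ Nonempty (F.Iso D.limit)

theorem IsProSaturated.isProFusion {p : ℕ} {F : FusionSystem S}
    (h : IsProSaturated.{u, v, w} p F) : IsProFusion.{u, v, w} p F := by
  obtain ⟨I, a, b, G, c, d, e, f, D, h1, -, h2⟩ := h
  exact ⟨I, a, b, G, c, d, e, f, D, h1, h2⟩

/-- Every endomorphism in an inverse limit is surjective. -/
theorem _root_.FusionInverseSystem.limit_surjective {I : Type v} [PartialOrder I]
    [IsDirectedOrder I] {G : I → Type w}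
    [∀ i, Group (G i)] [∀ i, TopologicalSpace (G i)] [∀ i, DiscreteTopology (G i)]
    [∀ i, Finite (G i)] (D : FusionInverseSystem I G) {P : ClosedSubgroup D.LimitGroup}
    {φ : P →ₜ* P} (hφ : φ ∈ D.limit.Hom P P) : Function.Surjective φ := by
  intro y
  let X : I → Set P := fun i => {x | D.proj i (φ x) = D.proj i y}
  have hcl : ∀ i, IsClosed (X i) := fun i =>
    isClosed_eq ((D.proj i).continuous_toFun.comp
      (continuous_subtype_val.comp φ.continuous_toFun)) continuous_const
  have hne : ∀ i, (X i).Nonempty := by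
    intro i
    obtain ⟨ψ, hψ, h⟩ := hφ i
    obtain ⟨⟨_, x, hx, rfl⟩, hz⟩ := (Finite.injective_iff_surjective.1
      ((D.sys i).injective hψ)) (P.toImage (D.proj i) y)
    refine ⟨⟨x, hx⟩, ?_⟩
    have := h ⟨x, hx⟩
    exact congrArg Subtype.val (this.symm.trans hz)
  have hmono : ∀ i j : I, i ≤ j → X j ⊆ X i := by
    intro i j hij x hx
    have h1 : ∀ z : D.LimitGroup, D.map hij (D.proj j z) = D.proj i z := fun z => z.2 i j hij
    change D.proj i (φ x) = D.proj i y
    rw [← h1, ← h1]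
    exact congrArg _ hx
  rcases isEmpty_or_nonempty I with hI | hI
  · exact ⟨y, Subtype.ext (D.limit_ext fun i => (hI.false i).elim)⟩
  · obtain ⟨x, hx⟩ := IsCompact.nonempty_iInter_of_directed_nonempty_isCompact_isClosed X
      (fun i j => by
        obtain ⟨k, hik, hjk⟩ := exists_ge_ge i j
        exact ⟨k, hmono i k hik, hmono j k hjk⟩)
      hne (fun i => (hcl i).isCompact) hcl
    exact ⟨x, Subtype.ext (D.limit_ext fun i => Set.mem_iInter.1 hx i)⟩

/-- Every endomorphism in a pro-fusion system is surjective. -/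
theorem IsProFusion.surjective {p : ℕ} {F : FusionSystem S} (hF : IsProFusion.{u, v, w} p F)
    {P : ClosedSubgroup S} {φ : P →ₜ* P} (hφ : φ ∈ F.Hom P P) : Function.Surjective φ := by
  obtain ⟨I, _, _, G, _, _, _, _, D, -, ⟨e⟩⟩ := hF
  obtain ⟨ψ, hψ, h⟩ := e.isMorphism P P φ hφ
  intro y
  obtain ⟨⟨_, x, hx, rfl⟩, hz⟩ := D.limit_surjective hψ (P.toImage _ y)
  refine ⟨⟨x, hx⟩, Subtype.ext (e.toEquiv.injective ?_)⟩
  have := h ⟨x, hx⟩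
  exact congrArg Subtype.val (this.symm.trans hz)

end Pro

/-! ## Quotients by open strongly closed subgroups -/

section Quotient

variable {S : Type u} [Group S] [TopologicalSpace S]

/-- The open strongly closed subgroups of `S`. -/
structure OSC (F : FusionSystem S) extends OpenSubgroup S where
  isStronglyClosed : F.IsStronglyClosed toOpenSubgroup.toSubgroup

namespace OSC

variable {F : FusionSystem S}

theorem ext_toSubgroup {M N : F.OSC} (h : M.toSubgroup = N.toSubgroup) : M = N := by
  obtain ⟨M, hM⟩ := M
  obtain ⟨N, hN⟩ := N
  obtain rfl : M = N := OpenSubgroup.toSubgroup_injective h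
  rfl

/-- Open strongly closed subgroups are ordered by reverse inclusion, so that smaller subgroups come
later in the inverse system. -/
instance : PartialOrder F.OSC where
  le M N := N.toSubgroup ≤ M.toSubgroup
  le_refl _ := le_rfl
  le_trans _ _ _ h h' := le_trans h' h
  le_antisymm _ _ h h' := ext_toSubgroup (le_antisymm h' h)

instance : IsDirectedOrder F.OSC where
  directed M N := by
    refine ⟨⟨M.toOpenSubgroup ⊓ N.toOpenSubgroup, fun R φ hφ h x => ?_⟩, ?_, ?_⟩
    · exact ⟨M.isStronglyClosed R φ hφ (fun y hy => (h hy).1) x,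
        N.isStronglyClosed R φ hφ (fun y hy => (h hy).2) x⟩
    · exact fun x hx => hx.1
    · exact fun x hx => hx.2

variable [IsTopologicalGroup S]

/-- An open strongly closed subgroup as a closed subgroup. -/
def toClosed (N : F.OSC) : ClosedSubgroup S :=
  ⟨N.toSubgroup, N.toOpenSubgroup.isClosed⟩

instance (N : F.OSC) : N.toSubgroup.Normal where
  conj_mem := by
    intro n hn s
    let c : N.toClosed →ₜ* ClosedSubgroup.whole S :=
      { toFun := fun x => ⟨s * x * s⁻¹, trivial⟩
        map_one' := Subtype.ext (by simp)
        map_mul' := fun a b => Subtype.ext (by simp)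
        continuous_toFun := by
          refine Continuous.subtype_mk ?_ _
          exact (continuous_const.mul continuous_subtype_val).mul continuous_const }
    exact N.isStronglyClosed N.toClosed c (F.conj_mem c s fun _ => rfl) le_rfl ⟨n, hn⟩

/-- The quotient group `S / N`. -/
abbrev Quot (N : F.OSC) : Type u := S ⧸ N.toSubgroup

instance [CompactSpace S] (N : F.OSC) : Finite N.Quot :=
  finite_of_compact_of_discrete

/-- The quotient map `S → S / N`. -/
def quotientMk (N : F.OSC) : S →ₜ* N.Quot :=
  { QuotientGroup.mk' N.toSubgroup with continuous_toFun := continuous_quot_mk }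

theorem quotientMk_eq_iff (N : F.OSC) {x y : S} : N.quotientMk x = N.quotientMk y ↔ x⁻¹ * y ∈ N.toSubgroup :=
  QuotientGroup.eq

theorem quotientMk_surjective (N : F.OSC) : Function.Surjective N.quotientMk :=
  QuotientGroup.mk_surjective

/-- The natural map `S / N → S / M` for `N ≤ M`. -/
def quotMap {M N : F.OSC} (h : M ≤ N) : N.Quot →ₜ* M.Quot where
  toMonoidHom := QuotientGroup.map N.toSubgroup M.toSubgroup (MonoidHom.id S) h
  continuous_toFun := continuous_of_discreteTopology

theorem quotMap_quotientMk {M N : F.OSC} (h : M ≤ N) (x : S) : quotMap h (N.quotientMk x) = M.quotientMk x := rfl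

end OSC

variable [IsTopologicalGroup S]

/-- The homomorphisms `φ : A → B` between subgroups of `S / N` that are induced by a morphism
`ψ` of `F` from the full preimage of `A` to `S`. -/
def quotientHom (F : FusionSystem S) (N : F.OSC) (A B : ClosedSubgroup N.Quot) : Set (A →ₜ* B) :=
  {φ | ∃ ψ ∈ F.Hom (A.preimage N.quotientMk) (ClosedSubgroup.whole S),
    ∀ u : A.preimage N.quotientMk, (φ ⟨N.quotientMk u, u.2⟩ : N.Quot) = N.quotientMk (ψ u)}

theorem toClosed_le_preimage {F : FusionSystem S} (N : F.OSC) (A : ClosedSubgroup N.Quot) :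
    N.toClosed ≤ A.preimage N.quotientMk := by
  intro x hx
  change N.quotientMk x ∈ A
  have : N.quotientMk x = 1 := (QuotientGroup.eq_one_iff x).2 hx
  rw [this]
  exact one_mem A

variable [CompactSpace S] [T2Space S]

/-- A morphism of a pro-fusion system defined on a subgroup containing `N` maps `N` onto `N`. -/
theorem IsProFusion.exists_of_mem {p : ℕ} {F : FusionSystem S} (hF : IsProFusion.{u, v, w} p F)
    (N : F.OSC) {P : ClosedSubgroup S} (hNP : N.toClosed ≤ P)
    {ψ : P →ₜ* ClosedSubgroup.whole S} (hψ : ψ ∈ F.Hom P (ClosedSubgroup.whole S))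
    {n : S} (hn : n ∈ N.toSubgroup) : ∃ m : P, (m : S) ∈ N.toSubgroup ∧ (ψ m : S) = n := by
  have h1 := F.comp_mem (F.inclusion_mem hNP) hψ
  obtain ⟨χ, hχ, h⟩ := F.hom_codRestrict (Q := N.toClosed) h1
    fun x => N.isStronglyClosed N.toClosed _ h1 le_rfl x
  obtain ⟨m, hm⟩ := hF.surjective hχ ⟨n, hn⟩
  refine ⟨⟨m, hNP m.2⟩, m.2, ?_⟩
  exact (h m).symm.trans (congrArg Subtype.val hm)

theorem quotientHom_injective (F : FusionSystem S) {p : ℕ} (hF : IsProFusion.{u, v, w} p F)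
    (N : F.OSC) {A B : ClosedSubgroup N.Quot} {φ : A →ₜ* B} (hφ : φ ∈ F.quotientHom N A B) :
    Function.Injective φ := by
  obtain ⟨ψ, hψ, h⟩ := hφ
  refine (injective_iff_map_eq_one φ).2 ?_
  rintro ⟨a, ha⟩ ha1
  obtain ⟨u, rfl⟩ := N.quotientMk_surjective a
  have h1 := h ⟨u, ha⟩
  rw [ha1] at h1
  have h2 : (ψ ⟨u, ha⟩ : S) ∈ N.toSubgroup := (QuotientGroup.eq_one_iff _).1 h1.symm
  obtain ⟨m, hm, hm2⟩ := hF.exists_of_mem N (toClosed_le_preimage N A) hψ h2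
  have h3 : m = ⟨u, ha⟩ := F.injective hψ (Subtype.ext hm2)
  refine Subtype.ext ((QuotientGroup.eq_one_iff _).2 ?_)
  rw [h3] at hm
  exact hm

/-- The quotient `F / N` of a pro-fusion system by an open strongly closed subgroup. -/
def quotient (F : FusionSystem S) {p : ℕ} (hF : IsProFusion.{u, v, w} p F) (N : F.OSC) :
    FusionSystem N.Quot where
  Hom := F.quotientHom N
  injective := F.quotientHom_injective hF N
  id_mem A := ⟨_, F.inclusion_mem (P := A.preimage N.quotientMk) (Q := ClosedSubgroup.whole S)
    (fun _ _ => trivial), fun _ => rfl⟩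
  comp_mem := by
    rintro A B C φ χ ⟨ψ, hψ, h⟩ ⟨ω, hω, h'⟩
    obtain ⟨ψ', hψ', k⟩ := F.hom_codRestrict (Q := B.preimage N.quotientMk) hψ fun x => by
      change N.quotientMk (ψ x) ∈ B
      rw [← h]
      exact (φ _).2
    refine ⟨_, F.comp_mem hψ' hω, fun u => ?_⟩
    have : φ ⟨N.quotientMk u, u.2⟩ = ⟨N.quotientMk (ψ' u), (ψ' u).2⟩ := Subtype.ext ((h u).trans (congrArg N.quotientMk (k u).symm))
    change (χ (φ ⟨N.quotientMk u, u.2⟩) : N.Quot) = N.quotientMk (ω (ψ' u))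
    rw [this]
    exact h' (ψ' u)
  conj_mem := by
    intro A B φ s hs
    obtain ⟨t, rfl⟩ := N.quotientMk_surjective s
    let c : A.preimage N.quotientMk →ₜ* ClosedSubgroup.whole S :=
      { toFun := fun x => ⟨t * x * t⁻¹, trivial⟩
        map_one' := Subtype.ext (by simp)
        map_mul' := fun a b => Subtype.ext (by simp)
        continuous_toFun := by
          refine Continuous.subtype_mk ?_ _
          exact (continuous_const.mul continuous_subtype_val).mul continuous_const }
    refine ⟨c, F.conj_mem c t fun _ => rfl, fun u => ?_⟩
    rw [hs]
    rfl
  factor := by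
    rintro A B φ ⟨ψ, hψ, h⟩
    let ρ : A →* N.Quot := (B.toSubgroup.subtype).comp φ.toMonoidHom
    let R : ClosedSubgroup N.Quot := ClosedSubgroup.ofDiscrete ρ.range
    have hRB : R ≤ B := by
      rintro _ ⟨x, rfl⟩
      exact (φ x).2
    let θ : A →ₜ* R :=
      { toFun := fun x => ⟨φ x, x, rfl⟩
        map_one' := Subtype.ext (by simp)
        map_mul' := fun x y => Subtype.ext (by simp)
        continuous_toFun := continuous_of_discreteTopology }
    have hθb : Function.Bijective θ := by
      constructor
      · intro x y hxy
        exact F.quotientHom_injective hF N ⟨ψ, hψ, h⟩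
          (Subtype.ext (congrArg (fun z : R => (z : N.Quot)) hxy))
      · rintro ⟨_, x, rfl⟩
        exact ⟨x, rfl⟩
    let e : A ≃* R := MulEquiv.ofBijective θ hθb
    let θ' : R →ₜ* A := { e.symm.toMonoidHom with
      continuous_toFun := continuous_of_discreteTopology }
    have h1 : ∀ x, θ' (θ x) = x := fun x => e.symm_apply_apply x
    have h2 : ∀ y, θ (θ' y) = y := fun y => e.apply_symm_apply y
    refine ⟨R, hRB, θ, ⟨ψ, hψ, h⟩, θ', ?_, h1, h2, rfl⟩
    obtain ⟨T, hT, τ, hτ, τ', hτ', k1, k2, rfl⟩ := F.factor hψ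
    have hRT : R.preimage N.quotientMk ≤ T := by
      rintro x ⟨⟨a, ha⟩, hx⟩
      obtain ⟨u, rfl⟩ := N.quotientMk_surjective a
      have hx' : N.quotientMk (τ ⟨u, ha⟩) = N.quotientMk x := (h ⟨u, ha⟩).symm.trans hx
      have hn := N.quotientMk_eq_iff.1 hx'
      obtain ⟨m, -, hm2⟩ := hF.exists_of_mem N (toClosed_le_preimage N A) hψ hn
      have hm3 : (τ m : S) = (τ ⟨u, ha⟩ : S)⁻¹ * x := hm2
      have : x = (τ ⟨u, ha⟩ : S) * τ m := by rw [hm3]; group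
      rw [this]
      exact mul_mem (τ ⟨u, ha⟩).2 (τ m).2
    refine ⟨_, F.comp_mem (F.inclusion_mem hRT) (F.comp_mem hτ'
      (F.inclusion_mem (Q := ClosedSubgroup.whole S) fun _ _ => trivial)), fun u => ?_⟩
    let v : A.preimage N.quotientMk := τ' (ClosedSubgroup.inclusion hRT u)
    change (θ' ⟨N.quotientMk u, u.2⟩ : N.Quot) = N.quotientMk v
    have h3 : θ ⟨N.quotientMk v, v.2⟩ = ⟨N.quotientMk u, u.2⟩ := by
      refine Subtype.ext ?_
      change (φ ⟨N.quotientMk v, v.2⟩ : N.Quot) = N.quotientMk u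
      rw [h v]
      change N.quotientMk (τ (τ' (ClosedSubgroup.inclusion hRT u))) = _
      rw [k2]
      rfl
    rw [← h3, h1]

/-- The inverse system of the quotients `F / N`, with the natural maps between the groups `S / N`,
given that these maps are morphisms of fusion systems. -/
def quotientSystem (F : FusionSystem S) {p : ℕ} (hF : IsProFusion.{u, v, w} p F)
    (h : ∀ (M N : F.OSC) (hMN : M ≤ N),
      (F.quotient hF N).IsMorphism (F.quotient hF M) (OSC.quotMap hMN)) :
    FusionInverseSystem F.OSC (fun N => N.Quot) where
  sys N := F.quotient hF N
  map hMN := OSC.quotMap hMN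
  map_self N x := by
    obtain ⟨u, rfl⟩ := N.quotientMk_surjective x
    rfl
  map_map {M N K} hMN hNK x := by
    obtain ⟨u, rfl⟩ := K.quotientMk_surjective x
    rfl
  isMorphism := h _ _

end Quotient

end FusionSystem

/-! Everything rests on one extension property: if `N` is open and strongly `F`-closed, every
`F`-morphism on `P` agrees modulo `N` with an `F`-morphism on `PN`. The latter preserves `N`, so it
induces a morphism of `F/N`; hence `S → S/N` and `S/N → S/M` are morphisms. Conversely, let `F` be
the limit of saturated `F_i` with projections `f_i : S → G_i`. The kernels of the `f_i` are open,
strongly closed and intersect trivially, so `S` is the limit of the `S/N` by compactness. A morphism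
of the limit of the `F/N`, taken at `N = ker f_i`, lifts to `F` modulo `N` and then induces a
morphism of `F_i`; as this holds for all `i`, it is a morphism of `F`.

For a saturated system on a finite `p`-group and `T` strongly closed, the property is
`IsSaturated.extendsModulo`, by downward induction on `|P|`. An isomorphism `f : P → R` is written
`h⁻¹ (h f g⁻¹) g` with isomorphisms `g : P → Q`, `h : R → Q` onto a fully normalized `Q`. Sylow's
theorem in `Aut(Q)` lets `g` and `h` be chosen so that they extend to the normalizers; a Frattini
argument changes `h f g⁻¹` modulo `T` into an automorphism that extends to `N_T(Q)`.

For the limit, the difficulty is that `f_k(N)` need not be strongly `F_k`-closed, as `F_k` may have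
morphisms that do not come from `F`. By `Iso.exists_forall_isStronglyClosed` its preimage in `G_j`
is strongly closed for all large `j`. The finite theorem at these levels and the compactness
principle `Iso.exists_morOn_of_forall` give `Iso.exists_extension`.

Morphisms are treated as functions `S → S` with a specified domain (`MorOn`), so that codomains need
not be carried along. -/

namespace FusionSystem

/-! ### Morphisms of a fusion system as functions with a domain -/

section MorOn

variable {S : Type u} [Group S] [TopologicalSpace S] {F : FusionSystem S}

/-- `F.MorOn P f`: the subgroup `P` is closed and the restriction of the function `f` to `P` is a
morphism of `F` from `P` to `S`. -/
def MorOn (F : FusionSystem S) (P : Subgroup S) (f : S → S) : Prop :=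
  ∃ hP : IsClosed (P : Set S), ∃ φ ∈ F.Hom ⟨P, hP⟩ (ClosedSubgroup.whole S),
    ∀ x (hx : x ∈ P), (φ ⟨x, hx⟩ : S) = f x

theorem exists_morOn {P Q : ClosedSubgroup S} {φ : P →ₜ* Q} (hφ : φ ∈ F.Hom P Q) :
    ∃ f, F.MorOn P.toSubgroup f ∧ ∀ x : P, f x = φ x := by
  classical
  -- The value `1` outside `P` is arbitrary.
  refine ⟨fun x => if h : x ∈ P then φ ⟨x, h⟩ else 1, ⟨P.isClosed', _, F.comp_mem hφ
    (F.inclusion_mem (Q := ClosedSubgroup.whole S) fun _ _ => trivial), fun x hx => ?_⟩,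
    fun x => ?_⟩
  · exact (dif_pos (c := x ∈ P) (t := fun h => (φ ⟨x, h⟩ : S)) hx).symm
  · exact dif_pos x.2

namespace MorOn

variable {P Q : Subgroup S} {f g : S → S}

theorem isClosed (h : F.MorOn P f) : IsClosed (P : Set S) := h.1

theorem map_mul (h : F.MorOn P f) {x y : S} (hx : x ∈ P) (hy : y ∈ P) :
    f (x * y) = f x * f y := by
  obtain ⟨hP, φ, -, hf⟩ := h
  rw [← hf x hx, ← hf y hy, ← hf _ (mul_mem hx hy)]
  exact congrArg Subtype.val (_root_.map_mul φ ⟨x, hx⟩ ⟨y, hy⟩)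

theorem map_one (h : F.MorOn P f) : f 1 = 1 := by
  have := h.map_mul (one_mem P) (one_mem P)
  simpa using this

theorem map_inv (h : F.MorOn P f) {x : S} (hx : x ∈ P) : f x⁻¹ = (f x)⁻¹ := by
  rw [eq_inv_iff_mul_eq_one, ← h.map_mul (inv_mem hx) hx, inv_mul_cancel, h.map_one]

theorem injOn (h : F.MorOn P f) : Set.InjOn f P := by
  obtain ⟨hP, φ, hφ, hf⟩ := h
  intro x hx y hy hxy
  rw [← hf x hx, ← hf y hy] at hxy
  exact congrArg Subtype.val (F.injective hφ (Subtype.ext hxy))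

theorem congr (h : F.MorOn P f) (hfg : ∀ x ∈ P, f x = g x) : F.MorOn P g := by
  obtain ⟨hP, φ, hφ, hf⟩ := h
  exact ⟨hP, φ, hφ, fun x hx => (hf x hx).trans (hfg x hx)⟩

theorem mono (h : F.MorOn P f) (hQ : IsClosed (Q : Set S)) (hQP : Q ≤ P) : F.MorOn Q f := by
  obtain ⟨hP, φ, hφ, hf⟩ := h
  exact ⟨hQ, _, F.comp_mem (F.inclusion_mem (P := ⟨Q, hQ⟩) (Q := ⟨P, hP⟩) hQP) hφ,
    fun x hx => hf x (hQP hx)⟩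

/-- The morphism given by `f`, with a prescribed codomain. -/
theorem exists_hom {P Q : ClosedSubgroup S} (h : F.MorOn P.toSubgroup f) (hQ : ∀ x ∈ P, f x ∈ Q) :
    ∃ φ ∈ F.Hom P Q, ∀ x : P, (φ x : S) = f x := by
  obtain ⟨hP, ψ, hψ, hf⟩ := h
  obtain ⟨χ, hχ, k⟩ := F.hom_codRestrict (P := P) (Q := Q) hψ fun x => by
    rw [show (ψ x : S) = f x from hf x x.2]
    exact hQ x x.2
  exact ⟨χ, hχ, fun x => (k x).trans (hf x x.2)⟩

theorem comp (h : F.MorOn P f) (h' : F.MorOn Q g) (hfQ : ∀ x ∈ P, f x ∈ Q) :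
    F.MorOn P (g ∘ f) := by
  obtain ⟨φ, hφ, k⟩ := h.exists_hom (P := ⟨P, h.isClosed⟩) (Q := ⟨Q, h'.isClosed⟩) hfQ
  obtain ⟨hQ, ψ, hψ, hg⟩ := h'
  refine ⟨h.isClosed, _, F.comp_mem hφ hψ, fun x hx => ?_⟩
  change (ψ (φ ⟨x, hx⟩) : S) = g (f x)
  rw [← k ⟨x, hx⟩]
  exact hg _ (φ ⟨x, hx⟩).2

/-- The inverse of a morphism, defined on its image. -/
theorem exists_inverse (h : F.MorOn P f) :
    ∃ (R : Subgroup S) (g : S → S), F.MorOn R g ∧ (∀ y, y ∈ R ↔ ∃ x ∈ P, f x = y) ∧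
      (∀ x ∈ P, g (f x) = x) ∧ (∀ y ∈ R, g y ∈ P ∧ f (g y) = y) := by
  obtain ⟨hP, φ, hφ, hf⟩ := h
  obtain ⟨R, hR, θ, hθ, θ', hθ', h1, h2, rfl⟩ := F.factor hφ
  obtain ⟨g, hg, k⟩ := exists_morOn hθ'
  have hf' : ∀ x (hx : x ∈ P), (θ ⟨x, hx⟩ : S) = f x := hf
  refine ⟨R.toSubgroup, g, hg, fun y => ⟨fun hy => ?_, ?_⟩, fun x hx => ?_, fun y hy => ?_⟩
  · refine ⟨θ' ⟨y, hy⟩, (θ' ⟨y, hy⟩).2, ?_⟩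
    rw [← hf' _ (θ' ⟨y, hy⟩).2]
    exact congrArg Subtype.val (h2 ⟨y, hy⟩)
  · rintro ⟨x, hx, rfl⟩
    rw [← hf' x hx]
    exact (θ ⟨x, hx⟩).2
  · rw [← hf' x hx, k]
    exact congrArg Subtype.val (h1 ⟨x, hx⟩)
  · rw [k ⟨y, hy⟩]
    refine ⟨(θ' ⟨y, hy⟩).2, ?_⟩
    rw [← hf' _ (θ' ⟨y, hy⟩).2]
    exact congrArg Subtype.val (h2 ⟨y, hy⟩)

end MorOn

theorem morOn_conj [IsTopologicalGroup S] (F : FusionSystem S) {P : Subgroup S}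
    (hP : IsClosed (P : Set S)) (s : S) : F.MorOn P fun x => s * x * s⁻¹ := by
  let c : (⟨P, hP⟩ : ClosedSubgroup S) →ₜ* ClosedSubgroup.whole S :=
    { toFun := fun x => ⟨s * x * s⁻¹, trivial⟩
      map_one' := Subtype.ext (by simp)
      map_mul' := fun a b => Subtype.ext (by simp)
      continuous_toFun := by
        refine Continuous.subtype_mk ?_ _
        exact (continuous_const.mul continuous_subtype_val).mul continuous_const }
  exact ⟨hP, c, F.conj_mem c s fun _ => rfl, fun _ _ => rfl⟩

theorem morOn_id (F : FusionSystem S) {P : Subgroup S} (hP : IsClosed (P : Set S)) :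
    F.MorOn P id :=
  ⟨hP, _, F.inclusion_mem (P := ⟨P, hP⟩) (Q := ClosedSubgroup.whole S) fun _ _ => trivial,
    fun _ _ => rfl⟩

theorem isStronglyClosed_iff {N : Subgroup S} :
    F.IsStronglyClosed N ↔ ∀ R f, F.MorOn R f → R ≤ N → ∀ x ∈ R, f x ∈ N := by
  constructor
  · rintro h R f ⟨hR, φ, hφ, hf⟩ hRN x hx
    rw [← hf x hx]
    exact h ⟨R, hR⟩ φ hφ hRN ⟨x, hx⟩
  · intro h R φ hφ hRN x
    obtain ⟨f, hf, k⟩ := exists_morOn hφ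
    rw [← k]
    exact h R.toSubgroup f hf hRN x x.2

theorem isMorphism_iff [CompactSpace S] [T2Space S] {T : Type v} [Group T] [TopologicalSpace T]
    [CompactSpace T] [T2Space T] {G : FusionSystem T} {α : S →ₜ* T} :
    F.IsMorphism G α ↔ ∀ P f, F.MorOn P f →
      ∃ g, G.MorOn (P.map α.toMonoidHom) g ∧ ∀ x ∈ P, g (α x) = α (f x) := by
  constructor
  · rintro h P f ⟨hP, φ, hφ, hf⟩
    obtain ⟨ψ, hψ, k⟩ := h _ _ φ hφ
    obtain ⟨g, hg, k'⟩ := exists_morOn hψ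
    refine ⟨g, hg, fun x hx => ?_⟩
    rw [← hf x hx]
    exact (k' (ClosedSubgroup.toImage α ⟨P, hP⟩ ⟨x, hx⟩)).trans
      (congrArg Subtype.val (k ⟨x, hx⟩))
  · intro h P Q φ hφ
    obtain ⟨f, hf, k⟩ := exists_morOn hφ
    obtain ⟨g, hg, k'⟩ := h _ f hf
    obtain ⟨ψ, hψ, k''⟩ := hg.exists_hom (P := P.image α) (Q := Q.image α) (by
      rintro _ ⟨x, hx, rfl⟩
      refine ⟨f x, ?_, (k' x hx).symm⟩
      rw [k ⟨x, hx⟩]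
      exact (φ ⟨x, hx⟩).2)
    refine ⟨ψ, hψ, fun x => Subtype.ext ?_⟩
    rw [k'']
    exact (k' x x.2).trans (congrArg α (k x))

end MorOn

end FusionSystem

/-! ### Sylow and normalizer arguments in finite groups -/

section Group

variable {G : Type*} [Group G]

/-- `P` is still a Sylow subgroup of `X`, so the conjugating element given by Sylow's theorem can be
taken in `X`. -/
theorem Sylow.exists_conj_mem_of_le {p : ℕ} [Fact p.Prime] [Finite G] (P : Sylow p G)
    {X H : Subgroup G} (hPX : (P : Subgroup G) ≤ X) (hHX : H ≤ X) (hH : IsPGroup p H) :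
    ∃ g ∈ X, ∀ h ∈ H, g * h * g⁻¹ ∈ P := by
  have hH' : IsPGroup p (H.subgroupOf X) :=
    hH.of_equiv (Subgroup.subgroupOfEquivOfLe hHX).symm
  obtain ⟨R, hR⟩ := hH'.exists_le_sylow
  obtain ⟨g, hg⟩ := MulAction.exists_smul_eq X R (P.subtype hPX)
  refine ⟨g, g.2, fun h hh => ?_⟩
  have h1 : (⟨h, hHX hh⟩ : X) ∈ R := hR hh
  have h2 : g * ⟨h, hHX hh⟩ * g⁻¹ ∈ g • R := by
    rw [← SetLike.mem_coe, Sylow.coe_smul]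
    exact ⟨_, h1, rfl⟩
  rw [hg] at h2
  exact h2

/-- A form of the Frattini argument. -/
theorem Sylow.exists_mem_normal_conj_mem {p : ℕ} [Fact p.Prime] [Finite G] (P : Sylow p G)
    (K : Subgroup G) [K.Normal] (γ : G) :
    ∃ κ ∈ K, ∀ a ∈ P, a ∈ K → (κ * γ) * a * (κ * γ)⁻¹ ∈ P := by
  -- The conjugate of `P ∩ K` by `γ` is a `p`-subgroup of `K`, hence of `PK`, where `P` is Sylow.
  have hp : IsPGroup p (((P : Subgroup G) ⊓ K).map (MulAut.conj γ).toMonoidHom) :=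
    (P.2.to_le inf_le_left).map _
  obtain ⟨g, hg, h⟩ := P.exists_conj_mem_of_le (X := (P : Subgroup G) ⊔ K) le_sup_left
    (by
      rintro _ ⟨a, ha, rfl⟩
      exact Subgroup.mem_sup_right (Subgroup.Normal.conj_mem ‹_› a ha.2 γ)) hp
  -- The factor `x` lies in `P`, so it normalizes `P` and can be dropped.
  obtain ⟨x, hx, κ, hκ, rfl⟩ := Subgroup.mem_sup_of_normal_right.1 hg
  refine ⟨κ, hκ, fun a ha haK => ?_⟩
  have h1 := h _ ⟨a, ⟨ha, haK⟩, rfl⟩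
  have h2 := mul_mem (mul_mem (inv_mem hx) h1) hx
  have h3 : κ * γ * a * (κ * γ)⁻¹ = x⁻¹ * (x * κ * (γ * a * γ⁻¹) * (x * κ)⁻¹) * x := by group
  rw [h3]
  exact h2

theorem IsPGroup.exists_normalizing {p : ℕ} [Fact p.Prime] [Finite G] (hG : IsPGroup p G)
    {H K : Subgroup G} (hHK : H < K) : ∃ x ∈ K, x ∉ H ∧ ∀ h ∈ H, x * h * x⁻¹ ∈ H := by
  have := (hG.to_subgroup K).isNilpotent
  have h1 := Group.normalizerCondition_of_isNilpotent (G := K) (H.subgroupOf K) (by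
    rw [lt_top_iff_ne_top, Ne, Subgroup.subgroupOf_eq_top]
    exact not_le_of_gt hHK)
  obtain ⟨x, hx, hxH⟩ := SetLike.exists_of_lt h1
  refine ⟨x, x.2, hxH, fun h hh => ?_⟩
  exact (Subgroup.mem_normalizer_iff.1 hx ⟨h, hHK.le hh⟩).1 hh

end Group

/-! ### Extension modulo a strongly closed subgroup, and receptivity -/

namespace FusionSystem

section Basic

variable {S : Type u} [Group S] [TopologicalSpace S] {F : FusionSystem S} {P Q T : Subgroup S}
  {f g : S → S}

theorem MorOn.card_eq {R : Subgroup S} (hf : F.MorOn P f) (hR : ∀ y, y ∈ R ↔ ∃ x ∈ P, f x = y) :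
    Nat.card R = Nat.card P := by
  have h : (R : Set S) = f '' P := Set.ext hR
  have h2 := hf.injOn.ncard_image
  rw [← h] at h2
  exact h2

theorem exists_morOn_of_mem_aut {Q : ClosedSubgroup S} {α : MulAut Q} (hα : α ∈ F.aut Q) :
    ∃ f, F.MorOn Q.toSubgroup f ∧ ∀ x : Q, f x = α x := by
  obtain ⟨φ, hφ, h⟩ := hα.1
  obtain ⟨f, hf, k⟩ := exists_morOn hφ
  exact ⟨f, hf, fun x => by rw [k, h]⟩

theorem IsStronglyClosed.normal [IsTopologicalGroup S] {T : Subgroup S} (hT : F.IsStronglyClosed T)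
    (hc : IsClosed (T : Set S)) : T.Normal :=
  ⟨fun n hn s => isStronglyClosed_iff.1 hT T _ (F.morOn_conj hc s) le_rfl n hn⟩

/-- The morphism `f` on `P` extends, modulo `T`, to a morphism on `P ⊔ T`. -/
def ExtendsModulo (F : FusionSystem S) (T P : Subgroup S) (f : S → S) : Prop :=
  ∃ g, F.MorOn (P ⊔ T) g ∧ ∀ u ∈ P, (f u)⁻¹ * g u ∈ T

theorem ExtendsModulo.of_le (h : F.MorOn P f) (hTP : T ≤ P) : F.ExtendsModulo T P f :=
  ⟨f, by rwa [sup_eq_left.2 hTP], fun u _ => by simp⟩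

theorem ExtendsModulo.congr (h : F.ExtendsModulo T P f) (hfg : ∀ x ∈ P, (g x)⁻¹ * f x ∈ T) :
    F.ExtendsModulo T P g := by
  obtain ⟨f', h1, h2⟩ := h
  exact ⟨f', h1, fun u hu => by simpa using mul_mem (hfg u hu) (h2 u hu)⟩

theorem MorOn.mem_iff_of_mapsTo [Finite S] (h : F.MorOn P f) (hQ : Q ≤ P) (hf : ∀ x ∈ Q, f x ∈ Q) :
    ∀ y, y ∈ Q ↔ ∃ x ∈ Q, f x = y := by
  refine fun y => ⟨fun hy => ?_, ?_⟩
  · have hinj : Function.Injective fun x : Q => (⟨f x, hf x x.2⟩ : Q) := fun a b hab =>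
      Subtype.ext (h.injOn (hQ a.2) (hQ b.2) (congrArg Subtype.val hab))
    obtain ⟨x, hx⟩ := Finite.injective_iff_surjective.1 hinj ⟨y, hy⟩
    exact ⟨x, x.2, congrArg Subtype.val hx⟩
  · rintro ⟨x, hx, rfl⟩
    exact hf x hx

theorem MorOn.exists_mem_aut [Finite S] {Q : ClosedSubgroup S} (h : F.MorOn Q.toSubgroup f)
    (hf : ∀ x ∈ Q, f x ∈ Q) : ∃ α ∈ F.aut Q, ∀ x : Q, (α x : S) = f x := by
  obtain ⟨φ, hφ, k⟩ := h.exists_hom (Q := Q) hf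
  obtain ⟨R, g, hg, hR, h1, h2⟩ := h.exists_inverse
  obtain rfl : R = Q.toSubgroup := by
    ext y
    rw [hR, ← h.mem_iff_of_mapsTo le_rfl hf]
  obtain ⟨χ, hχ, k'⟩ := hg.exists_hom (P := Q) (Q := Q) fun x hx => (h2 x hx).1
  let α : MulAut Q :=
    { φ.toMonoidHom with
      invFun := χ
      left_inv := fun x => Subtype.ext (by
        change (χ (φ x) : S) = x
        rw [k', k, h1 x x.2])
      right_inv := fun x => Subtype.ext (by
        change (φ (χ x) : S) = x
        rw [k, k', (h2 x x.2).2]) }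
  exact ⟨α, ⟨⟨φ, hφ, fun _ => rfl⟩, χ, hχ, fun _ => rfl⟩, k⟩

end Basic

section Finite

variable {S : Type u} [Group S] [TopologicalSpace S] [DiscreteTopology S] {F : FusionSystem S}
  {P Q T : Subgroup S} {f g : S → S}

namespace ExtendsModulo

theorem mono (h : F.ExtendsModulo T P f) (hQ : Q ≤ P) : F.ExtendsModulo T Q f := by
  obtain ⟨f', h1, h2⟩ := h
  exact ⟨f', h1.mono (isClosed_discrete _) (sup_le_sup_right hQ T), fun u hu => h2 u (hQ hu)⟩

/-- The extension `f'` of `f` takes values in `f(u)T ⊆ QT` on `P`, and that of `g` preserves `T`, so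
the composite of the extensions differs from `g ∘ f` only by elements of `T`. -/
theorem comp (hT : F.IsStronglyClosed T) (hf : F.ExtendsModulo T P f)
    (hg : F.ExtendsModulo T Q g) (hPQ : ∀ x ∈ P, f x ∈ Q) : F.ExtendsModulo T P (g ∘ f) := by
  have hN := hT.normal (isClosed_discrete _)
  obtain ⟨f', h1, h2⟩ := hf
  obtain ⟨g', k1, k2⟩ := hg
  have hf'T : ∀ t ∈ T, f' t ∈ T := isStronglyClosed_iff.1 hT T f'
    (h1.mono (isClosed_discrete _) le_sup_right) le_rfl
  have hg'T : ∀ t ∈ T, g' t ∈ T := isStronglyClosed_iff.1 hT T g'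
    (k1.mono (isClosed_discrete _) le_sup_right) le_rfl
  have hmem : ∀ u ∈ P, f' u ∈ Q ⊔ T := fun u hu => by
    have := mul_mem (Subgroup.mem_sup_left (T := T) (hPQ u hu)) (Subgroup.mem_sup_right (h2 u hu))
    simpa using this
  refine ⟨g' ∘ f', h1.comp k1 fun x hx => ?_, fun u hu => ?_⟩
  · obtain ⟨u, hu, t, ht, rfl⟩ := Subgroup.mem_sup_of_normal_right.1 hx
    rw [h1.map_mul (Subgroup.mem_sup_left hu) (Subgroup.mem_sup_right ht)]
    exact mul_mem (hmem u hu) (Subgroup.mem_sup_right (hf'T t ht))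
  · have e : f' u = f u * ((f u)⁻¹ * f' u) := by group
    have := k1.map_mul (Subgroup.mem_sup_left (hPQ u hu)) (Subgroup.mem_sup_right (h2 u hu))
    rw [← e] at this
    change (g (f u))⁻¹ * g' (f' u) ∈ T
    rw [this, ← mul_assoc]
    exact mul_mem (k2 _ (hPQ u hu)) (hg'T _ (h2 u hu))

/-- The extension of `f` maps `T` into `T`, hence onto `T` by finiteness; its image therefore
contains `QT`, and its inverse is the required extension. -/
theorem inverse [Finite S] (hT : F.IsStronglyClosed T) (hf : F.ExtendsModulo T P f)
    (hgf : ∀ x ∈ P, g (f x) = x) (hQ : ∀ y ∈ Q, ∃ x ∈ P, f x = y) : F.ExtendsModulo T Q g := by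
  obtain ⟨f', h1, h2⟩ := hf
  have hf'T := h1.mem_iff_of_mapsTo (Q := T) le_sup_right (isStronglyClosed_iff.1 hT T f'
    (h1.mono (isClosed_discrete _) le_sup_right) le_rfl)
  obtain ⟨R, g', hg', hR, k1, k2⟩ := h1.exists_inverse
  have hg'T : ∀ t ∈ T, g' t ∈ T := by
    intro t ht
    obtain ⟨s, hs, rfl⟩ := (hf'T t).1 ht
    rwa [k1 _ (Subgroup.mem_sup_right hs)]
  have hTR : T ≤ R := fun t ht => by
    obtain ⟨s, hs, rfl⟩ := (hf'T t).1 ht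
    exact (hR _).2 ⟨s, Subgroup.mem_sup_right hs, rfl⟩
  have hf'R : ∀ x ∈ P, f' x ∈ R := fun x hx => (hR _).2 ⟨x, Subgroup.mem_sup_left hx, rfl⟩
  have hTi : ∀ x ∈ P, (f' x)⁻¹ * f x ∈ T := fun x hx => by
    simpa using inv_mem (h2 x hx)
  refine ⟨g', hg'.mono (isClosed_discrete _) (sup_le (fun y hy => ?_) hTR), fun y hy => ?_⟩
  · obtain ⟨x, hx, rfl⟩ := hQ y hy
    simpa using mul_mem (hf'R x hx) (hTR (hTi x hx))
  · obtain ⟨x, hx, rfl⟩ := hQ y hy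
    have e : f x = f' x * ((f' x)⁻¹ * f x) := by group
    have := hg'.map_mul (hf'R x hx) (hTR (hTi x hx))
    rw [← e, k1 _ (Subgroup.mem_sup_left hx)] at this
    rw [hgf x hx, this]
    simpa using hg'T _ (hTi x hx)

end ExtendsModulo

variable [Finite S]

/-- Receptivity in terms of functions on `S`. -/
theorem IsReceptive.exists_extension {Q : ClosedSubgroup S} (hQ : F.IsReceptive Q)
    (hf : F.MorOn P f) (hPQ : ∀ y, y ∈ Q ↔ ∃ x ∈ P, f x = y) :
    ∃ W g, F.MorOn W g ∧ (∀ x ∈ P, x ∈ W ∧ g x = f x) ∧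
      ∀ x y, (∀ u ∈ P, x * u * x⁻¹ ∈ P ∧ f (x * u * x⁻¹) = y * f u * y⁻¹) → x ∈ W := by
  obtain ⟨φ, hφ, k⟩ := hf.exists_hom (P := ⟨P, hf.isClosed⟩) (Q := Q)
    fun x hx => (hPQ _).2 ⟨x, hx, rfl⟩
  obtain ⟨R, f', hf', hR, h1, h2⟩ := hf.exists_inverse
  obtain rfl : R = Q.toSubgroup := by
    ext y
    rw [hR]
    exact (hPQ y).symm
  obtain ⟨χ, hχ, k'⟩ := hf'.exists_hom (P := Q) (Q := ⟨P, hf.isClosed⟩) fun y hy => (h2 y hy).1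
  obtain ⟨ψ, hψ, hψφ⟩ := hQ _ φ ⟨hφ, χ, hχ, fun x => Subtype.ext (by rw [k', k, h1 x x.2]),
    fun y => Subtype.ext (by rw [k, k', (h2 y y.2).2])⟩
  obtain ⟨g, hg, kg⟩ := exists_morOn hψ
  -- Since `P` and `Q` are finite, being conjugated into themselves already puts `x` and `y` in the
  -- normalizers.
  have key : ∀ x y, (∀ u ∈ P, x * u * x⁻¹ ∈ P ∧ f (x * u * x⁻¹) = y * f u * y⁻¹) →
      x ∈ extensionSubgroup φ := by
    intro x y hxy
    refine ⟨Subgroup.mem_normalizer_fintype fun u hu => (hxy u hu).1, y,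
      Subgroup.mem_normalizer_fintype fun v hv => ?_, fun u v huv => ?_⟩
    · obtain ⟨u, hu, rfl⟩ := (hPQ v).1 hv
      rw [← (hxy u hu).2]
      exact (hPQ _).2 ⟨_, (hxy u hu).1, rfl⟩
    · rw [k, k, huv, (hxy u u.2).2]
  have hPW : ∀ x ∈ P, x ∈ extensionSubgroup φ := fun x hx => key x (f x) fun u hu =>
    ⟨mul_mem (mul_mem hx hu) (inv_mem hx), by
      rw [hf.map_mul (mul_mem hx hu) (inv_mem hx), hf.map_mul hx hu, hf.map_inv hx]⟩
  refine ⟨extensionSubgroup φ, g, hg, fun x hx => ⟨hPW x hx, ?_⟩, key⟩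
  exact ((kg ⟨x, hPW x hx⟩).trans (hψφ ⟨x, hx⟩ ⟨x, hPW x hx⟩ rfl)).trans (k ⟨x, hx⟩)

end Finite

end FusionSystem

/-! ### The extension theorem for saturated systems on finite `p`-groups -/

namespace FusionSystem

section Saturated

variable {S : Type u} [Group S] [TopologicalSpace S] [DiscreteTopology S] [Finite S]
  {F : FusionSystem S} {p : ℕ} [Fact p.Prime] {P T : Subgroup S} {Q : ClosedSubgroup S} {f : S → S}

/-- An isomorphism onto a fully normalized subgroup can be corrected by an automorphism so that it
extends to the normalizer. -/
theorem IsFullyNormalized.exists_extension_normalizer (hp : IsPGroup p S)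
    (hQ : F.IsFullyNormalized p Q) (hf : F.MorOn P f) (hPQ : ∀ y, y ∈ Q ↔ ∃ x ∈ P, f x = y) :
    ∃ W g, F.MorOn W g ∧ P ≤ W ∧ (∀ x, (∀ u ∈ P, x * u * x⁻¹ ∈ P) → x ∈ W) ∧
      ∀ y, y ∈ Q ↔ ∃ x ∈ P, g x = y := by
  obtain ⟨hrec, P₀, hP₀⟩ := hQ
  have hcomp : ∀ {x : S} {α β : F.aut Q} {y : S}, (∀ u ∈ P, x * u * x⁻¹ ∈ P) →
      (∀ u ∈ P, y * u * y⁻¹ ∈ P) →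
      (∀ u : Q, ∀ v ∈ P, f v = u → ((α : MulAut Q) u : S) = f (x * v * x⁻¹)) →
      (∀ u : Q, ∀ v ∈ P, f v = u → ((β : MulAut Q) u : S) = f (y * v * y⁻¹)) →
      ∀ u : Q, ∀ v ∈ P, f v = u → (((α * β : F.aut Q) : MulAut Q) u : S) =
        f (x * y * v * (x * y)⁻¹) := by
    intro x α β y hx hy hα hβ u v hv hvu
    change ((α : MulAut Q) ((β : MulAut Q) u) : S) = _
    rw [hα _ _ (hy v hv) (hβ u v hv hvu).symm]
    congr 1
    group
  -- The automorphisms `f c_x f⁻¹` of `Q`, where `c_x` is conjugation by `x ∈ N_S(P)`. They form a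
  -- `p`-group because powers of `x` induce powers of the automorphism.
  let H : Subgroup (F.aut Q) :=
    { carrier := {α | ∃ x ∈ Subgroup.normalizer (P : Set S),
        ∀ u : Q, ∀ v ∈ P, f v = u → ((α : MulAut Q) u : S) = f (x * v * x⁻¹)}
      one_mem' := ⟨1, one_mem _, fun u v _ h => by simp [h]⟩
      mul_mem' := by
        rintro α β ⟨x, hx, hα⟩ ⟨y, hy, hβ⟩
        exact ⟨x * y, mul_mem hx hy, hcomp (fun u => (Subgroup.mem_normalizer_iff.1 hx u).1)
          (fun u => (Subgroup.mem_normalizer_iff.1 hy u).1) hα hβ⟩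
      inv_mem' := by
        rintro α ⟨x, hx, hα⟩
        refine ⟨x⁻¹, inv_mem hx, fun u v hv hvu => ?_⟩
        have hv' := (Subgroup.mem_normalizer_iff.1 (inv_mem hx) v).1 hv
        have h1 := hα ⟨f (x⁻¹ * v * x⁻¹⁻¹), (hPQ _).2 ⟨_, hv', rfl⟩⟩ _ hv' rfl
        have h2 : (α : MulAut Q) ⟨f (x⁻¹ * v * x⁻¹⁻¹), (hPQ _).2 ⟨_, hv', rfl⟩⟩ = u := by
          refine Subtype.ext (h1.trans (Eq.trans ?_ hvu))
          congr 1
          group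
        rw [← h2]
        exact congrArg Subtype.val (MulAut.inv_apply_self Q (α : MulAut Q) _) }
  have hH : IsPGroup p H := by
    rintro ⟨α, x, hx, hα⟩
    obtain ⟨k, hk⟩ := hp x
    refine ⟨k, Subtype.ext (Subtype.ext (MulEquiv.ext fun u => Subtype.ext ?_))⟩
    have hpow : ∀ n : ℕ, x ^ n ∈ Subgroup.normalizer (P : Set S) ∧ ∀ u : Q, ∀ v ∈ P, f v = u →
        (((α ^ n : F.aut Q) : MulAut Q) u : S) = f (x ^ n * v * (x ^ n)⁻¹) := by
      intro n
      induction n with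
      | zero => exact ⟨by simp, fun u v _ h => by simp [h]⟩
      | succ n ih =>
        refine ⟨pow_mem hx _, ?_⟩
        rw [pow_succ, pow_succ]
        exact hcomp (fun u => (Subgroup.mem_normalizer_iff.1 ih.1 u).1)
          (fun u => (Subgroup.mem_normalizer_iff.1 hx u).1) ih.2 hα
    obtain ⟨v, hv, hvu⟩ := (hPQ u).1 u.2
    refine ((hpow (p ^ k)).2 u v hv hvu).trans ?_
    rw [hk]
    simpa using hvu
  -- Conjugation by `χ` moves `H` into the Sylow subgroup of automorphisms induced by `S`. Hence
  -- `N_φ` for `φ = χ ∘ f` is all of `N_S(P)`, and receptivity applies to it.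
  obtain ⟨χ, -, hχ⟩ := P₀.exists_conj_mem_of_le (X := ⊤) le_top le_top hH
  obtain ⟨c, hc, hcχ⟩ := exists_morOn_of_mem_aut χ.2
  have hcQ : ∀ y ∈ Q, c y ∈ Q := fun y hy => by
    rw [hcχ ⟨y, hy⟩]
    exact ((χ : MulAut Q) ⟨y, hy⟩).2
  have hcf := hf.comp hc fun x hx => (hPQ _).2 ⟨x, hx, rfl⟩
  have hcfQ : ∀ y, y ∈ Q ↔ ∃ x ∈ P, (c ∘ f) x = y := by
    refine fun y => (hc.mem_iff_of_mapsTo le_rfl hcQ y).trans ⟨?_, ?_⟩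
    · rintro ⟨z, hz, rfl⟩
      obtain ⟨x, hx, rfl⟩ := (hPQ z).1 hz
      exact ⟨x, hx, rfl⟩
    · rintro ⟨x, hx, rfl⟩
      exact ⟨f x, (hPQ _).2 ⟨x, hx, rfl⟩, rfl⟩
  obtain ⟨W, g, hg, h1, h2⟩ := hrec.exists_extension hcf hcfQ
  refine ⟨W, g, hg, fun x hx => (h1 x hx).1, fun x hx => ?_, fun y => (hcfQ y).trans ?_⟩
  · have hxn : x ∈ Subgroup.normalizer (P : Set S) := Subgroup.mem_normalizer_fintype hx
    obtain ⟨R, f', hf', hR, k1, k2⟩ := hf.exists_inverse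
    obtain rfl : R = Q.toSubgroup := by
      ext y
      exact (hR y).trans (hPQ y).symm
    have hmor := (hf'.comp ((F.morOn_conj hf.isClosed x).comp hf hx) fun y hy => (k2 y hy).1)
    obtain ⟨α, hα, hαf⟩ := hmor.exists_mem_aut fun y hy => (hPQ _).2 ⟨_, hx _ (k2 y hy).1, rfl⟩
    have hαH : (⟨α, hα⟩ : F.aut Q) ∈ H := by
      refine ⟨x, hxn, fun u v hv hvu => ?_⟩
      refine (hαf u).trans ?_
      change f (x * f' u * x⁻¹) = _
      rw [← hvu, k1 v hv]
    have hmem : χ * ⟨α, hα⟩ * χ⁻¹ ∈ F.autInner Q := by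
      rw [← hP₀]
      exact hχ _ hαH
    obtain ⟨s, hs⟩ := hmem
    refine h2 x s fun u hu => ⟨hx u hu, ?_⟩
    have hfu : f u ∈ Q := (hPQ _).2 ⟨u, hu, rfl⟩
    have h3 := hs ((χ : MulAut Q) ⟨f u, hfu⟩)
    rw [← hcχ] at h3
    change c (f (x * u * x⁻¹)) = s * c (f u) * s⁻¹
    rw [← h3]
    change _ = ((χ : MulAut Q) (α ((χ : MulAut Q)⁻¹ ((χ : MulAut Q) ⟨f u, hfu⟩))) : S)
    rw [MulAut.inv_apply_self, ← hcχ, hαf]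
    change _ = c (f (x * f' (f u) * x⁻¹))
    rw [k1 u hu]
  · exact exists_congr fun x => and_congr_right fun hx => by rw [(h1 x hx).2]

/-- An automorphism of a fully normalized subgroup can be corrected, modulo a strongly closed
subgroup `T`, by an automorphism which extends to the normalizer in `T`. -/
theorem IsFullyNormalized.exists_extension_modulo (hQ : F.IsFullyNormalized p Q)
    (hT : F.IsStronglyClosed T) (hf : F.MorOn Q.toSubgroup f) (hfQ : ∀ x ∈ Q, f x ∈ Q) :
    ∃ W g, F.MorOn W g ∧ Q.toSubgroup ≤ W ∧
      (∀ x ∈ T, (∀ u ∈ Q, x * u * x⁻¹ ∈ Q) → x ∈ W) ∧ ∀ x ∈ Q, (f x)⁻¹ * g x ∈ T := by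
  have hN := hT.normal (isClosed_discrete _)
  obtain ⟨hrec, P₀, hP₀⟩ := hQ
  obtain ⟨γ, hγ, hγf⟩ := hf.exists_mem_aut hfQ
  have haut : ∀ (α : F.aut Q) (u : Q), (u : S) ∈ T → ((α : MulAut Q) u : S) ∈ T := by
    intro α u hu
    obtain ⟨a, ha, haα⟩ := exists_morOn_of_mem_aut α.2
    rw [← haα]
    exact isStronglyClosed_iff.1 hT (Q.toSubgroup ⊓ T) a
      (ha.mono (isClosed_discrete _) inf_le_left) inf_le_right u ⟨u.2, hu⟩
  -- The automorphisms that are trivial modulo `T`; normal because every automorphism preserves `Q ∩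
  -- T`.
  let K : Subgroup (F.aut Q) :=
    { carrier := {α | ∀ u : Q, (u : S)⁻¹ * ((α : MulAut Q) u : S) ∈ T}
      one_mem' := fun u => by simp
      mul_mem' := by
        intro α β hα hβ u
        have := mul_mem (hβ u) (hα ((β : MulAut Q) u))
        simpa [mul_assoc] using this
      inv_mem' := by
        intro α hα u
        have := inv_mem (hα ((α : MulAut Q)⁻¹ u))
        rw [MulAut.apply_inv_self] at this
        simpa using this }
  have hK : K.Normal := by
    refine ⟨fun α hα β u => ?_⟩
    have h1 := haut β (((β : MulAut Q)⁻¹ u)⁻¹ * (α : MulAut Q) ((β : MulAut Q)⁻¹ u))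
      (hα ((β : MulAut Q)⁻¹ u))
    rw [_root_.map_mul, _root_.map_inv, MulAut.apply_inv_self] at h1
    exact h1
  -- Correcting `γ` by `κ ∈ K` does not change it modulo `T`, and `κγ` conjugates `P₀ ∩ K` into
  -- `P₀`.
  obtain ⟨κ, hκ, h⟩ := P₀.exists_mem_normal_conj_mem K ⟨γ, hγ⟩
  obtain ⟨c, hc, hcκ⟩ := exists_morOn_of_mem_aut (κ * ⟨γ, hγ⟩).2
  have hcQ : ∀ y ∈ Q, c y ∈ Q := fun y hy => by
    rw [hcκ ⟨y, hy⟩]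
    exact (((κ * ⟨γ, hγ⟩ : F.aut Q) : MulAut Q) ⟨y, hy⟩).2
  obtain ⟨W, g, hg, h1, h2⟩ := hrec.exists_extension hc (hc.mem_iff_of_mapsTo le_rfl hcQ)
  refine ⟨W, g, hg, fun x hx => (h1 x hx).1, fun x hxT hx => ?_, fun x hx => ?_⟩
  -- Conjugation by `x ∈ T` lies in `P₀` and, `T` being normal, in `K`. Its conjugate by `κγ` is
  -- thus induced by some `s ∈ S`, which is the condition for `x` to lie in the extension subgroup
  -- of `κγ`.
  · obtain ⟨α, hα, hαx⟩ := (F.morOn_conj Q.isClosed' x).exists_mem_aut hx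
    have hαP : (⟨α, hα⟩ : F.aut Q) ∈ P₀ := by
      rw [← SetLike.mem_coe, ← Sylow.coe_coe, hP₀]
      exact ⟨x, hαx⟩
    have hαK : (⟨α, hα⟩ : F.aut Q) ∈ K := fun u => by
      change (u : S)⁻¹ * (α u : S) ∈ T
      rw [hαx, mul_assoc, ← mul_assoc, ← mul_assoc]
      refine mul_mem ?_ (inv_mem hxT)
      simpa using hN.conj_mem x hxT (u : S)⁻¹
    have hmem := h _ hαP hαK
    rw [← SetLike.mem_coe, ← Sylow.coe_coe, hP₀] at hmem
    obtain ⟨s, hs⟩ := hmem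
    refine h2 x s fun u hu => ⟨hx u hu, ?_⟩
    have h3 := hs (((κ * ⟨γ, hγ⟩ : F.aut Q) : MulAut Q) ⟨u, hu⟩)
    rw [← hcκ] at h3
    rw [← h3]
    have h4 : (((κ * ⟨γ, hγ⟩ * ⟨α, hα⟩ * (κ * ⟨γ, hγ⟩)⁻¹ : F.aut Q) : MulAut Q)
        (((κ * ⟨γ, hγ⟩ : F.aut Q) : MulAut Q) ⟨u, hu⟩)) =
        ((κ * ⟨γ, hγ⟩ : F.aut Q) : MulAut Q) (α ⟨u, hu⟩) :=
      congrArg (fun z => ((κ * ⟨γ, hγ⟩ : F.aut Q) : MulAut Q) (α z))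
        (MulAut.inv_apply_self Q ((κ * ⟨γ, hγ⟩ : F.aut Q) : MulAut Q) ⟨u, hu⟩)
    rw [h4, ← hcκ, hαx]
  · rw [(h1 x hx).2, hcκ ⟨x, hx⟩, ← hγf ⟨x, hx⟩]
    exact hκ (γ ⟨x, hx⟩)

/-- In a saturated fusion system, every morphism defined on `P` extends, modulo a strongly closed
subgroup `T`, to `P ⊔ T`. -/
theorem IsSaturated.extendsModulo (hF : F.IsSaturated p) (hp : IsPGroup p S)
    (hT : F.IsStronglyClosed T) (hf : F.MorOn P f) : F.ExtendsModulo T P f := by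
  have hN := hT.normal (isClosed_discrete _)
  induction hn : Nat.card S - Nat.card P using Nat.strong_induction_on generalizing P f with
  | _ n ih =>
  subst hn
  by_cases hTP : T ≤ P
  · exact .of_le hf hTP
  have hPS : Nat.card P < Nat.card S := by
    refine lt_of_le_of_ne (Subgroup.card_le_card_group P) fun h => hTP ?_
    rw [Subgroup.eq_top_of_card_eq P h]
    exact le_top
  -- The induction step: a morphism that extends from `R` to a strictly larger `W` is covered by the
  -- induction hypothesis for `W`.
  have lift : ∀ {R W g}, F.MorOn W g → R ≤ W → Nat.card R = Nat.card P →
      (∃ x ∈ W, x ∉ R) → F.ExtendsModulo T R g := by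
    rintro R W g hg hRW hR ⟨x, hxW, hxR⟩
    refine (ih _ ?_ hg rfl).mono hRW
    have h1 : R < W := lt_of_le_of_ne hRW fun h => hxR (h ▸ hxW)
    have h2 := Set.ncard_lt_ncard (s := (R : Set S)) (t := W) h1
    change Nat.card R < Nat.card W at h2
    omega
  obtain ⟨Q, φ, ⟨hφ, φ', hφ', k1, k2⟩, hQ⟩ := hF ⟨P, hf.isClosed⟩
  obtain ⟨a, ha, haφ⟩ := exists_morOn hφ
  change F.MorOn P a at ha
  have haQ : ∀ y, y ∈ Q ↔ ∃ x ∈ P, a x = y := by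
    refine fun y => ⟨fun hy => ⟨φ' ⟨y, hy⟩, (φ' ⟨y, hy⟩).2, ?_⟩, ?_⟩
    · rw [haφ, k2]
    · rintro ⟨x, hx, rfl⟩
      rw [haφ ⟨x, hx⟩]
      exact (φ ⟨x, hx⟩).2
  -- As `R` is proper in a `p`-group, its normalizer is strictly larger, so the corrected
  -- isomorphism onto `Q` falls under `lift`.
  have toQ : ∀ {R : Subgroup S} {b : S → S}, F.MorOn R b → (∀ y, y ∈ Q ↔ ∃ x ∈ R, b x = y) →
      Nat.card R = Nat.card P →
      ∃ g, F.MorOn R g ∧ F.ExtendsModulo T R g ∧ ∀ y, y ∈ Q ↔ ∃ x ∈ R, g x = y := by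
    intro R b hb hbQ hR
    obtain ⟨W, g, hg, hRW, hW, hgQ⟩ := hQ.exists_extension_normalizer hp hb hbQ
    refine ⟨g, hg.mono (isClosed_discrete _) hRW, lift hg hRW hR ?_, hgQ⟩
    have hlt : R < ⊤ := lt_top_iff_ne_top.2 fun h => by
      rw [h, Subgroup.card_top] at hR
      omega
    obtain ⟨x, -, hxR, hx⟩ := hp.exists_normalizing hlt
    exact ⟨x, hW x hx, hxR⟩
  obtain ⟨R, f', hf', hR, m1, m2⟩ := hf.exists_inverse
  -- Both ends of `f : P → R` are now identified with `Q`: by `g`, corrected from `a`, and by `h`,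
  -- corrected from `a ∘ f⁻¹`.
  obtain ⟨g, hg, hgT, hgQ⟩ := toQ ha haQ rfl
  obtain ⟨h, hh, hhT, hhQ⟩ := toQ (hf'.comp ha fun y hy => (m2 y hy).1) (fun y => (haQ y).trans
    ⟨fun ⟨x, hx, hxy⟩ => ⟨f x, (hR _).2 ⟨x, hx, rfl⟩, by rw [← hxy, Function.comp_apply, m1 x hx]⟩,
      fun ⟨x, hx, hxy⟩ => ⟨f' x, (m2 x hx).1, hxy⟩⟩) (hf.card_eq hR)
  obtain ⟨Q₁, g', hg', hQ₁, n1, n2⟩ := hg.exists_inverse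
  obtain rfl : Q₁ = Q.toSubgroup := by
    ext y
    exact (hQ₁ y).trans (hgQ y).symm
  obtain ⟨Q₂, h', hh', hQ₂, l1, l2⟩ := hh.exists_inverse
  have hfR : ∀ x ∈ P, f x ∈ R := fun x hx => (hR _).2 ⟨x, hx, rfl⟩
  have hhR : ∀ x ∈ R, h x ∈ Q := fun x hx => (hhQ _).2 ⟨x, hx, rfl⟩
  have hc := (hg'.comp hf fun y hy => (n2 y hy).1).comp hh fun y hy => hfR _ (n2 y hy).1
  have hcT : F.ExtendsModulo T Q.toSubgroup (h ∘ f ∘ g') := by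
    by_cases hTQ : T ≤ Q.toSubgroup
    · exact .of_le hc hTQ
    obtain ⟨W, k, hk, hQW, hTW, hkc⟩ := hQ.exists_extension_modulo hT hc
      fun y hy => hhR _ (hfR _ (n2 y hy).1)
    refine (lift hk hQW (hg.card_eq hgQ) ?_).congr hkc
    -- Some `qt` in `QT` outside `Q` normalizes `Q`. Then so does `t`, which lies in `T` but not in
    -- `Q`, and this makes `W` strictly larger than `Q`.
    obtain ⟨x, hx, hxQ, hxn⟩ := hp.exists_normalizing
      (lt_of_le_of_ne le_sup_left fun h => hTQ (h ▸ le_sup_right) : Q.toSubgroup < Q.toSubgroup ⊔ T)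
    obtain ⟨q, hq, t, ht, rfl⟩ := Subgroup.mem_sup_of_normal_right.1 hx
    refine ⟨t, hTW t ht fun u hu => ?_, fun htQ => hxQ (mul_mem hq htQ)⟩
    have e : t * u * t⁻¹ = q⁻¹ * (q * t * u * (q * t)⁻¹) * q := by group
    rw [e]
    exact mul_mem (mul_mem (inv_mem hq) (hxn u hu)) hq
  have hinv := hhT.inverse (Q := Q.toSubgroup) hT l1 fun y hy => (hhQ y).1 hy
  refine ((hgT.comp hT hcT fun x hx => (hgQ _).2 ⟨x, hx, rfl⟩).comp hT hinv fun x hx =>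
    hhR _ (hfR _ (n2 _ ((hgQ _).2 ⟨x, hx, rfl⟩)).1)).congr fun x hx => ?_
  change (f x)⁻¹ * h' (h (f (g' (g x)))) ∈ T
  rw [n1 x hx, l1 _ (hfR x hx), inv_mul_cancel]
  exact one_mem T

end Saturated

end FusionSystem

/-! ### Inverse limits and compactness -/

/-- Multiplicativity and continuity of `f` on `P` are not assumed: both can be checked in each
coordinate, where `f` is induced by a morphism of a finite system. -/
theorem FusionInverseSystem.limit_morOn_iff {I : Type v} [PartialOrder I] {G : I → Type w}
    [∀ i, Group (G i)] [∀ i, TopologicalSpace (G i)] [∀ i, DiscreteTopology (G i)]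
    [∀ i, Finite (G i)] (D : FusionInverseSystem I G) {P : Subgroup D.LimitGroup}
    (hP : IsClosed (P : Set D.LimitGroup)) {f : D.LimitGroup → D.LimitGroup} :
    D.limit.MorOn P f ↔ ∀ i, ∃ g, (D.sys i).MorOn (P.map (D.proj i).toMonoidHom) g ∧
      ∀ x ∈ P, g (D.proj i x) = D.proj i (f x) := by
  constructor
  · rintro ⟨hP, φ, hφ, hf⟩ i
    obtain ⟨ψ, hψ, h⟩ := hφ i
    obtain ⟨g, hg, k⟩ := FusionSystem.exists_morOn hψ
    refine ⟨g, hg, fun x hx => ?_⟩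
    rw [← hf x hx]
    exact (k (ClosedSubgroup.toImage _ ⟨P, hP⟩ ⟨x, hx⟩)).trans (congrArg Subtype.val (h ⟨x, hx⟩))
  · intro h
    choose g hg k using h
    have hmul : ∀ x ∈ P, ∀ y ∈ P, f (x * y) = f x * f y := by
      intro x hx y hy
      refine D.limit_ext fun i => ?_
      rw [map_mul, ← k i x hx, ← k i y hy, ← k i _ (mul_mem hx hy), map_mul]
      exact (hg i).map_mul ⟨x, hx, rfl⟩ ⟨y, hy, rfl⟩
    let φ : (⟨P, hP⟩ : ClosedSubgroup D.LimitGroup) →ₜ* ClosedSubgroup.whole D.LimitGroup :=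
      { toFun := fun x => ⟨f x, trivial⟩
        map_one' := Subtype.ext (by
          have := hmul 1 (one_mem P) 1 (one_mem P)
          simpa using this)
        map_mul' := fun x y => Subtype.ext (hmul x x.2 y y.2)
        continuous_toFun := by
          refine Continuous.subtype_mk (Continuous.subtype_mk (continuous_pi fun i => ?_) _) _
          refine Continuous.congr (f := fun x : (⟨P, hP⟩ : ClosedSubgroup D.LimitGroup) =>
            g i (D.proj i x)) ?_ fun x => k i x x.2
          exact (continuous_of_discreteTopology (f := g i)).comp
            ((D.proj i).continuous_toFun.comp continuous_subtype_val) }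
    refine ⟨hP, φ, fun i => ?_, fun _ _ => rfl⟩
    obtain ⟨ψ, hψ, k'⟩ := (hg i).exists_hom
      (P := ClosedSubgroup.image (D.proj i) ⟨P, hP⟩)
      (Q := ClosedSubgroup.image (D.proj i) (ClosedSubgroup.whole _)) (by
        rintro _ ⟨x, hx, rfl⟩
        exact ⟨f x, trivial, (k i x hx).symm⟩)
    exact ⟨ψ, hψ, fun x => Subtype.ext ((k' _).trans (k i x x.2))⟩

namespace FusionSystem

namespace Iso

section

variable {S : Type u} [Group S] [TopologicalSpace S] [CompactSpace S] [T2Space S]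
  {F : FusionSystem S}

theorem morOn_iff {T : Type v} [Group T] [TopologicalSpace T] [CompactSpace T] [T2Space T]
    {G : FusionSystem T} (e : F.Iso G) {P : Subgroup S} {f : S → S} :
    F.MorOn P f ↔ G.MorOn (P.map (e.toEquiv : S →ₜ* T).toMonoidHom)
      fun x => e.toEquiv (f (e.toEquiv.symm x)) := by
  constructor
  · intro h
    obtain ⟨g, hg, k⟩ := isMorphism_iff.1 e.isMorphism P f h
    refine hg.congr ?_
    rintro _ ⟨x, hx, rfl⟩
    refine (k x hx).trans ?_
    exact congrArg (fun z => e.toEquiv (f z)) (e.toEquiv.symm_apply_apply x).symm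
  · intro h
    obtain ⟨g, hg, k⟩ := isMorphism_iff.1 e.isMorphism_symm _ _ h
    have hP : (P.map (e.toEquiv : S →ₜ* T).toMonoidHom).map
        (e.toEquiv.symm : T →ₜ* S).toMonoidHom = P := by
      ext x
      constructor
      · rintro ⟨_, ⟨y, hy, rfl⟩, rfl⟩
        exact (e.toEquiv.symm_apply_apply y).symm ▸ hy
      · exact fun hx => ⟨_, ⟨x, hx, rfl⟩, e.toEquiv.symm_apply_apply x⟩
    rw [hP] at hg
    refine hg.congr fun x hx => ?_
    have := k (e.toEquiv x) ⟨x, hx, rfl⟩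
    change g (e.toEquiv.symm (e.toEquiv x)) = e.toEquiv.symm (e.toEquiv _) at this
    simpa only [ContinuousMulEquiv.symm_apply_apply] using this

end

section

variable {S : Type u} [Group S] [TopologicalSpace S] [CompactSpace S] [T2Space S]
  {F : FusionSystem S} {I : Type v} [PartialOrder I] {G : I → Type w}
  [∀ i, Group (G i)] [∀ i, TopologicalSpace (G i)] [∀ i, DiscreteTopology (G i)]
  [∀ i, Finite (G i)] {D : FusionInverseSystem I G} (e : F.Iso D.limit)

/-- The projections of a group isomorphic to an inverse limit. -/
def proj (i : I) : S →ₜ* G i :=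
  (D.proj i).comp (e.toEquiv : S →ₜ* D.LimitGroup)

theorem map_proj {i j : I} (h : i ≤ j) (s : S) : D.map h (e.proj j s) = e.proj i s :=
  (e.toEquiv s).2 i j h

theorem proj_ext {s t : S} (h : ∀ i, e.proj i s = e.proj i t) : s = t :=
  e.toEquiv.injective (D.limit_ext h)

theorem exists_proj_eq {x : ∀ i, G i} (hx : ∀ i j (h : i ≤ j), D.map h (x j) = x i) :
    ∃ s, ∀ i, e.proj i s = x i := by
  refine ⟨e.toEquiv.symm ⟨x, hx⟩, fun i => ?_⟩
  change D.proj i (e.toEquiv (e.toEquiv.symm ⟨x, hx⟩)) = x i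
  rw [ContinuousMulEquiv.apply_symm_apply]
  rfl

theorem map_map_proj {i j : I} (h : i ≤ j) (P : Subgroup S) :
    (P.map (e.proj j).toMonoidHom).map (D.map h).toMonoidHom = P.map (e.proj i).toMonoidHom := by
  rw [Subgroup.map_map]
  congr 1
  ext s
  exact e.map_proj h s

theorem morOn_iff_proj {P : Subgroup S} (hP : IsClosed (P : Set S)) {f : S → S} :
    F.MorOn P f ↔ ∀ i, ∃ g, (D.sys i).MorOn (P.map (e.proj i).toMonoidHom) g ∧
      ∀ x ∈ P, g (e.proj i x) = e.proj i (f x) := by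
  have hc : IsClosed (P.map (e.toEquiv : S →ₜ* D.LimitGroup).toMonoidHom : Set D.LimitGroup) :=
    (ClosedSubgroup.image (e.toEquiv : S →ₜ* D.LimitGroup) ⟨P, hP⟩).isClosed'
  rw [e.morOn_iff, D.limit_morOn_iff hc]
  refine forall_congr' fun i => exists_congr fun g => ?_
  rw [Subgroup.map_map]
  refine and_congr Iff.rfl ⟨fun h x hx => ?_, ?_⟩
  · refine (h _ ⟨x, hx, rfl⟩).trans ?_
    exact congrArg (fun z => e.proj i (f z)) (e.toEquiv.symm_apply_apply x)
  · rintro h _ ⟨x, hx, rfl⟩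
    refine (h x hx).trans ?_
    exact congrArg (fun z => e.proj i (f z)) (e.toEquiv.symm_apply_apply x).symm

/-- A morphism exists on `P` if suitable compatible morphisms exist on cofinally many of the images
of `P` in the groups of the inverse system. -/
theorem exists_morOn_of_forall [IsDirectedOrder I] (k : I) {P : Subgroup S}
    (hP : IsClosed (P : Set S)) (Θ : (P → G k) → Prop)
    (h : ∀ j (hkj : k ≤ j), ∃ (l : I) (hjl : j ≤ l) (g : G l → G l),
      (D.sys l).MorOn (P.map (e.proj l).toMonoidHom) g ∧
        Θ fun x => D.map (hkj.trans hjl) (g (e.proj l x))) :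
    ∃ f, F.MorOn P f ∧ Θ fun x => e.proj k (f x) := by
  classical
  let A : ∀ j, k ≤ j → Set (G j → G j) := fun j hkj =>
    {g | (D.sys j).MorOn (P.map (e.proj j).toMonoidHom) g ∧ Θ fun x => D.map hkj (g (e.proj j x))}
  -- `Z j` consists of the functions whose `j`-th coordinate comes from an admissible morphism `g`
  -- and determines all coordinates below `j`. It is closed, being a finite union over `g` of sets
  -- cut out by closed conditions on coordinates.
  let Z : {j // k ≤ j} → Set (P → ∀ i, G i) := fun j =>
    ⋃ g ∈ A j j.2, {φ | ∀ x, φ x j = g (e.proj j x) ∧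
      ∀ (i : I) (hij : i ≤ j), D.map hij (φ x j) = φ x i}
  have hcl : ∀ j, IsClosed (Z j) := by
    intro j
    refine (Set.toFinite _).isClosed_biUnion fun g _ => ?_
    simp only [Set.ofPred_forall, Set.ofPred_and]
    refine isClosed_iInter fun x => IsClosed.inter ?_ (isClosed_iInter fun i =>
      isClosed_iInter fun hij => ?_)
    · exact isClosed_eq ((continuous_apply _).comp (continuous_apply x)) continuous_const
    · exact isClosed_eq ((D.map hij).continuous_toFun.comp
        ((continuous_apply _).comp (continuous_apply x)))
        ((continuous_apply _).comp (continuous_apply x))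
  have hmono : ∀ i j : {j // k ≤ j}, i ≤ j → Z j ⊆ Z i := by
    intro i j hij φ hφ
    obtain ⟨g, ⟨hg, hΘ⟩, hφ⟩ := Set.mem_iUnion₂.1 hφ
    obtain ⟨g', hg', k'⟩ := isMorphism_iff.1 (D.isMorphism hij) _ _ hg
    rw [e.map_map_proj] at hg'
    have hgg : ∀ x : P, g' (e.proj i x) = D.map hij (g (e.proj j x)) := fun x => by
      rw [← e.map_proj hij]
      exact k' _ ⟨x, x.2, rfl⟩
    refine Set.mem_iUnion₂.2 ⟨g', ⟨hg', ?_⟩, fun x => ⟨?_, fun l hli => ?_⟩⟩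
    · convert hΘ using 2 with x
      rw [hgg, D.map_map]
    · rw [hgg, ← (hφ x).1, (hφ x).2]
    · rw [← (hφ x).2 i hij, D.map_map, (hφ x).2]
  have hne : ∀ j, (Z j).Nonempty := by
    intro j
    obtain ⟨l, hjl, g, hg, hΘ⟩ := h j j.2
    -- Coordinates not below `l` are unconstrained in `Z l` and are set to `1`.
    refine Set.Nonempty.mono (hmono j ⟨l, j.2.trans hjl⟩ hjl)
      ⟨fun x i => if hil : i ≤ l then D.map hil (g (e.proj l x)) else 1,
        Set.mem_iUnion₂.2 ⟨g, ⟨hg, hΘ⟩, fun x => ⟨?_, fun i hil => ?_⟩⟩⟩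
    · exact (dif_pos le_rfl).trans (D.map_self _ _)
    · have hil' : i ≤ l := hil
      simp only [le_refl, hil', dif_pos, D.map_map]
  have : Nonempty {j // k ≤ j} := ⟨⟨k, le_rfl⟩⟩
  obtain ⟨φ, hφ⟩ := IsCompact.nonempty_iInter_of_directed_nonempty_isCompact_isClosed Z
    (fun i j => by
      obtain ⟨l, hil, hjl⟩ := exists_ge_ge (i : I) j
      exact ⟨⟨l, i.2.trans hil⟩, hmono _ _ hil, hmono _ _ hjl⟩)
    hne (fun j => (hcl j).isCompact) hcl
  have hφ' := fun j => Set.mem_iUnion₂.1 (Set.mem_iInter.1 hφ j)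
  choose g hg hgφ using hφ'
  have hlim : ∀ x : P, ∃ s, ∀ i, e.proj i s = φ x i := by
    refine fun x => e.exists_proj_eq fun i j hij => ?_
    obtain ⟨l, hkl, hjl⟩ := exists_ge_ge k j
    rw [← (hgφ ⟨l, hkl⟩ x).2 j hjl, D.map_map]
    exact (hgφ ⟨l, hkl⟩ x).2 i (hij.trans hjl)
  choose s hs using hlim
  have hf : ∀ x : P, (if hx : (x : S) ∈ P then s ⟨x, hx⟩ else 1) = s x := fun x => dif_pos x.2
  refine ⟨fun x => if hx : x ∈ P then s ⟨x, hx⟩ else 1, (e.morOn_iff_proj hP).2 fun i => ?_, ?_⟩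
  -- The index `i` need not lie above `k`; the morphism at a common upper bound `l` induces one at
  -- `i`.
  · obtain ⟨l, hkl, hil⟩ := exists_ge_ge k i
    obtain ⟨g', hg', k'⟩ := isMorphism_iff.1 (D.isMorphism hil) _ _ (hg ⟨l, hkl⟩).1
    rw [e.map_map_proj] at hg'
    refine ⟨g', hg', fun x hx => ?_⟩
    rw [dif_pos hx, hs, ← (hgφ ⟨l, hkl⟩ ⟨x, hx⟩).2 i hil, (hgφ ⟨l, hkl⟩ ⟨x, hx⟩).1,
      ← e.map_proj hil]
    exact k' _ ⟨x, hx, rfl⟩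
  · convert (hg ⟨k, le_rfl⟩).2 using 2 with x
    refine (congrArg (e.proj k) (hf x)).trans ?_
    rw [hs, ← (hgφ ⟨k, le_rfl⟩ x).1, D.map_self]

end

end Iso

end FusionSystem

/-! ### Strongly closed subgroups and extension in the limit -/

namespace FusionSystem

theorem IsMorphism.isStronglyClosed_ker {S : Type u} [Group S] [TopologicalSpace S]
    [CompactSpace S] [T2Space S] {T : Type v} [Group T] [TopologicalSpace T] [CompactSpace T]
    [T2Space T] {F : FusionSystem S} {G : FusionSystem T} {α : S →ₜ* T} (h : F.IsMorphism G α) :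
    F.IsStronglyClosed α.toMonoidHom.ker := by
  refine isStronglyClosed_iff.2 fun R f hf hR x hx => ?_
  obtain ⟨g, hg, k⟩ := isMorphism_iff.1 h R f hf
  have h1 : α x = 1 := hR hx
  change α (f x) = 1
  rw [← k x hx, h1, hg.map_one]

namespace Iso

variable {S : Type u} [Group S] [TopologicalSpace S] [CompactSpace S] [T2Space S]
  {F : FusionSystem S} {I : Type v} [PartialOrder I] {G : I → Type w}
  [∀ i, Group (G i)] [∀ i, TopologicalSpace (G i)] [∀ i, DiscreteTopology (G i)]
  [∀ i, Finite (G i)] {D : FusionInverseSystem I G} (e : F.Iso D.limit)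

theorem isMorphism_proj (i : I) : F.IsMorphism (D.sys i) (e.proj i) :=
  isMorphism_iff.2 fun _ _ hf => (e.morOn_iff_proj hf.isClosed).1 hf i

/-- The kernels are closed, directed and intersect trivially, so by compactness one of them lies in
the open neighbourhood `N` of `1`. -/
theorem exists_ker_proj_le [IsDirectedOrder I] [Nonempty I] {N : Subgroup S}
    (hN : IsOpen (N : Set S)) : ∃ k, (e.proj k).toMonoidHom.ker ≤ N := by
  refine exists_subset_nhds_of_isCompact' (V := fun i => {s : S | e.proj i s = 1})
    (fun i j => ?_) (fun i => IsClosed.isCompact ?_) (fun i => ?_) fun x hx => ?_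
  · obtain ⟨l, hil, hjl⟩ := exists_ge_ge i j
    refine ⟨l, fun s hs => ?_, fun s hs => ?_⟩
    · change e.proj i s = 1
      rw [← e.map_proj hil, show e.proj l s = 1 from hs, map_one]
    · change e.proj j s = 1
      rw [← e.map_proj hjl, show e.proj l s = 1 from hs, map_one]
  · exact isClosed_eq (e.proj i).continuous_toFun continuous_const
  · exact isClosed_eq (e.proj i).continuous_toFun continuous_const
  · have h1 : x = 1 := e.proj_ext fun i => (Set.mem_iInter.1 hx i).trans (map_one _).symm
    exact hN.mem_nhds (h1 ▸ one_mem N)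

section

variable [IsDirectedOrder I] {p : ℕ} [Fact p.Prime]

/-- A strongly closed subgroup which contains the kernel of a projection comes from strongly closed
subgroups of the groups of the inverse system, from some index on. -/
theorem exists_forall_isStronglyClosed (hp : ∀ i, IsPGroup p (G i))
    (hD : ∀ i, (D.sys i).IsSaturated p) {N : Subgroup S} (hN : F.IsStronglyClosed N) {k : I}
    (hk : (e.proj k).toMonoidHom.ker ≤ N) :
    ∃ (m : I) (hkm : k ≤ m), ∀ j (hmj : m ≤ j), (D.sys j).IsStronglyClosed
      ((N.map (e.proj k).toMonoidHom).comap (D.map (hkm.trans hmj)).toMonoidHom) := by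
  have hmem : ∀ s, e.proj k s ∈ N.map (e.proj k).toMonoidHom → s ∈ N := by
    rintro s ⟨n, hn, hns⟩
    have h1 : n⁻¹ * s ∈ (e.proj k).toMonoidHom.ker := by
      change e.proj k (n⁻¹ * s) = 1
      rw [map_mul, map_inv, inv_mul_eq_one]
      exact hns
    simpa using mul_mem hn (hk h1)
  -- For one subgroup `A` of `f_k(N)`: if morphisms leading out of `f_k(N)` existed at arbitrarily
  -- high levels, compactness would yield a morphism of `F` leading out of `N`. As `G k` has
  -- finitely many subgroups, a single bound `M` serves all `A`.
  have key : ∀ A : {A : Subgroup (G k) // A ≤ N.map (e.proj k).toMonoidHom}, ∃ m, ∃ hkm : k ≤ m,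
      ∀ l (hml : m ≤ l) g,
        (D.sys l).MorOn ((A.1.comap (e.proj k).toMonoidHom).map (e.proj l).toMonoidHom) g →
        ∀ s, e.proj k s ∈ A.1 →
          D.map (hkm.trans hml) (g (e.proj l s)) ∈ N.map (e.proj k).toMonoidHom := by
    rintro ⟨A, hA⟩
    by_contra! hcon
    obtain ⟨f, hf, ⟨s, hs⟩, hfs⟩ := e.exists_morOn_of_forall k
      (P := A.comap (e.proj k).toMonoidHom)
      ((isClosed_discrete (A : Set (G k))).preimage (e.proj k).continuous_toFun)
      (fun a => ∃ x, a x ∉ N.map (e.proj k).toMonoidHom) (fun j hkj => by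
        obtain ⟨l, hjl, g, hg, s, hs, hgs⟩ := hcon j hkj
        exact ⟨l, hjl, g, hg, ⟨s, hs⟩, hgs⟩)
    exact hfs ⟨f s, isStronglyClosed_iff.1 hN _ f hf (fun x hx => hmem x (hA hx)) s hs, rfl⟩
  choose m hkm hm using key
  have : Nonempty I := ⟨k⟩
  obtain ⟨M, hM⟩ := Finite.exists_le m
  have hkM : k ≤ M := (hkm ⟨⊥, bot_le⟩).trans (hM _)
  refine ⟨M, hkM, fun j hMj => isStronglyClosed_iff.2 fun R φ hφ hR r hr => ?_⟩
  let L := (D.map (hkM.trans hMj)).toMonoidHom.ker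
  have hL : (D.sys j).IsStronglyClosed L := (D.isMorphism _).isStronglyClosed_ker
  -- `R` need not contain the image in `G j` of the preimage of `A` in `S`, but `R ⊔ L` does.
  -- Extending modulo `L` makes `hm` applicable and does not change values in `G k`; this is where
  -- saturation is used.
  obtain ⟨ψ, hψ, hψφ⟩ := (hD j).extendsModulo (hp j) hL hφ
  have hψL : ∀ t ∈ L, ψ t ∈ L := isStronglyClosed_iff.1 hL L ψ
    (hψ.mono (isClosed_discrete _) le_sup_right) le_rfl
  let A := R.map (D.map (hkM.trans hMj)).toMonoidHom
  have hA : A ≤ N.map (e.proj k).toMonoidHom := Subgroup.map_le_iff_le_comap.2 hR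
  have hAR : (A.comap (e.proj k).toMonoidHom).map (e.proj j).toMonoidHom ≤ R ⊔ L := by
    rintro _ ⟨s, ⟨r, hr, hrs⟩, rfl⟩
    have h1 : r⁻¹ * e.proj j s ∈ L := by
      change D.map _ (r⁻¹ * e.proj j s) = 1
      rw [map_mul, map_inv, e.map_proj, inv_mul_eq_one]
      exact hrs
    have h2 := mul_mem (Subgroup.mem_sup_left hr) (Subgroup.mem_sup_right (S := R) h1)
    rwa [mul_inv_cancel_left] at h2
  obtain ⟨s, hs, hrs⟩ := hR hr
  change e.proj k s = D.map _ r at hrs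
  have h1 := hm ⟨A, hA⟩ j ((hM _).trans hMj) ψ (hψ.mono (isClosed_discrete _) hAR) s
    ⟨r, hr, hrs.symm⟩
  have h2 : r⁻¹ * e.proj j s ∈ L := by
    change D.map _ (r⁻¹ * e.proj j s) = 1
    rw [map_mul, map_inv, e.map_proj, inv_mul_eq_one]
    exact hrs.symm
  have h3 : e.proj j s = r * (r⁻¹ * e.proj j s) := by group
  have h4 : D.map (hkM.trans hMj) (φ r) = D.map (hkM.trans hMj) (ψ (e.proj j s)) := by
    rw [h3, hψ.map_mul (Subgroup.mem_sup_left hr) (Subgroup.mem_sup_right h2), map_mul,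
      show D.map _ (ψ (r⁻¹ * e.proj j s)) = 1 from hψL _ h2, mul_one, ← inv_mul_eq_one, ← map_inv,
      ← map_mul]
    exact hψφ r hr
  change D.map (hkM.trans hMj) (φ r) ∈ N.map (e.proj k).toMonoidHom
  rw [h4]
  exact h1

/-- A morphism defined on `P` extends, modulo an open strongly closed subgroup `N`, to `P ⊔ N`. -/
theorem exists_extension [IsTopologicalGroup S] (e : F.Iso D.limit)
    (hp : ∀ i, IsPGroup p (G i)) (hD : ∀ i, (D.sys i).IsSaturated p) {N : Subgroup S}
    (hN : F.IsStronglyClosed N)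
    (hNo : IsOpen (N : Set S)) {P : Subgroup S} {f : S → S} (hf : F.MorOn P f) :
    ∃ g, F.MorOn (P ⊔ N) g ∧ ∀ u ∈ P, (f u)⁻¹ * g u ∈ N := by
  have hPN : IsClosed ((P ⊔ N : Subgroup S) : Set S) :=
    Subgroup.isClosed_of_isOpen _ (Subgroup.isOpen_mono le_sup_right hNo)
  rcases isEmpty_or_nonempty I with hI | hI
  -- A limit over the empty index set is the trivial group.
  · have hS : ∀ x y : S, x = y := fun x y => e.proj_ext fun i => (hI.false i).elim
    exact ⟨id, F.morOn_id hPN, fun u _ => (hS 1 ((f u)⁻¹ * id u)) ▸ one_mem N⟩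
  obtain ⟨k, hk⟩ := e.exists_ker_proj_le hNo
  obtain ⟨m, hkm, hm⟩ := e.exists_forall_isStronglyClosed hp hD hN hk
  -- The predicate says that the extension agrees with `f` modulo `N`. It can be tested in `G k`,
  -- since `N` contains the kernel of `f_k`, so it survives the passage to the limit.
  obtain ⟨g, hg, hgf⟩ := e.exists_morOn_of_forall k hPN
    (fun a => ∀ u (hu : u ∈ P), (e.proj k (f u))⁻¹ * a ⟨u, Subgroup.mem_sup_left hu⟩ ∈
      N.map (e.proj k).toMonoidHom) (fun j hkj => by
    obtain ⟨l, hml, hjl⟩ := exists_ge_ge m j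
    obtain ⟨φ, hφ, hφf⟩ := (e.morOn_iff_proj hf.isClosed).1 hf l
    obtain ⟨ψ, hψ, hψφ⟩ := (hD l).extendsModulo (hp l) (hm l hml) hφ
    refine ⟨l, hjl, ψ, hψ.mono (isClosed_discrete _) ?_, fun u hu => ?_⟩
    · rw [Subgroup.map_sup]
      refine sup_le_sup le_rfl ?_
      rintro _ ⟨n, hn, rfl⟩
      exact ⟨n, hn, (e.map_proj _ n).symm⟩
    · have := hψφ _ ⟨u, hu, rfl⟩
      change D.map (hkm.trans hml) ((φ (e.proj l u))⁻¹ * ψ (e.proj l u)) ∈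
        N.map (e.proj k).toMonoidHom at this
      rwa [hφf u hu, map_mul, map_inv, e.map_proj] at this)
  refine ⟨g, hg, fun u hu => ?_⟩
  obtain ⟨n, hn, h1⟩ := hgf u hu
  change e.proj k n = (e.proj k (f u))⁻¹ * e.proj k (g u) at h1
  have h2 : n⁻¹ * ((f u)⁻¹ * g u) ∈ (e.proj k).toMonoidHom.ker := by
    change e.proj k (n⁻¹ * ((f u)⁻¹ * g u)) = 1
    rw [map_mul, map_mul, map_inv, map_inv, h1, inv_mul_cancel]
  simpa using mul_mem hn (hk h2)

end

end Iso

end FusionSystem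

/-! ### The quotients `F / N` and the limit of the groups `S / N` -/

namespace FusionSystem

theorem OSC.nonempty {S : Type u} [Group S] [TopologicalSpace S] {F : FusionSystem S} :
    Nonempty F.OSC :=
  ⟨⟨⊤, fun _ _ _ _ _ => trivial⟩⟩

section Quotient

variable {S : Type u} [Group S] [TopologicalSpace S] [IsTopologicalGroup S] [CompactSpace S]
  [T2Space S] {F : FusionSystem S} {p : ℕ} (hF : IsProFusion.{u, v, w} p F)

/-- A morphism of `F` defined on a subgroup containing `N` induces a morphism of `F / N`. -/
theorem exists_quotient_morOn (N : F.OSC) {R : Subgroup S} {h : S → S} (hh : F.MorOn R h)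
    (hNR : N.toSubgroup ≤ R) :
    ∃ g, (F.quotient hF N).MorOn (R.map N.quotientMk.toMonoidHom) g ∧
      ∀ u ∈ R, g (N.quotientMk u) = N.quotientMk (h u) := by
  have hmem : ∀ u, N.quotientMk u ∈ R.map N.quotientMk.toMonoidHom → u ∈ R := by
    rintro u ⟨v, hv, hvu⟩
    simpa using mul_mem hv (hNR (N.quotientMk_eq_iff.1 hvu))
  have hhN : ∀ n ∈ N.toSubgroup, h n ∈ N.toSubgroup :=
    isStronglyClosed_iff.1 N.isStronglyClosed N.toSubgroup h
      (hh.mono N.toOpenSubgroup.isClosed hNR) le_rfl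
  -- The induced map is defined through an arbitrary section `r`; it does not depend on `r` because
  -- `h` maps `N` into `N`.
  let r : N.Quot → S := Function.surjInv N.quotientMk_surjective
  have hr : ∀ u, N.quotientMk (r u) = u := Function.surjInv_eq N.quotientMk_surjective
  have hg : ∀ u ∈ R, N.quotientMk (h (r (N.quotientMk u))) = N.quotientMk (h u) := by
    intro u hu
    have h1 := N.quotientMk_eq_iff.1 (hr (N.quotientMk u)).symm
    have h2 : r (N.quotientMk u) = u * (u⁻¹ * r (N.quotientMk u)) := by group
    rw [h2, hh.map_mul hu (hNR h1)]
    refine (N.quotientMk_eq_iff.2 ?_).symm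
    rw [inv_mul_cancel_left]
    exact hhN _ h1
  let φ : (⟨R.map N.quotientMk.toMonoidHom, isClosed_discrete _⟩ : ClosedSubgroup N.Quot) →ₜ*
      ClosedSubgroup.whole N.Quot :=
    { toFun := fun x => ⟨N.quotientMk (h (r x)), trivial⟩
      map_one' := Subtype.ext (by
        have := hg 1 (one_mem R)
        rwa [map_one, hh.map_one, map_one] at this)
      map_mul' := by
        rintro ⟨_, x, hx, rfl⟩ ⟨_, y, hy, rfl⟩
        refine Subtype.ext ?_
        change N.quotientMk (h (r (N.quotientMk x * N.quotientMk y))) =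
          N.quotientMk (h (r (N.quotientMk x))) * N.quotientMk (h (r (N.quotientMk y)))
        rw [← map_mul, hg _ (mul_mem hx hy), hg x hx, hg y hy, hh.map_mul hx hy, map_mul]
      continuous_toFun := continuous_of_discreteTopology }
  refine ⟨fun x => N.quotientMk (h (r x)), ⟨isClosed_discrete _, φ, ?_, fun _ _ => rfl⟩, hg⟩
  let A : ClosedSubgroup N.Quot := ⟨R.map N.quotientMk.toMonoidHom, isClosed_discrete _⟩
  obtain ⟨ψ, hψ, k⟩ := (hh.mono (A.preimage N.quotientMk).isClosed' hmem).exists_hom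
    (P := A.preimage N.quotientMk) (Q := ClosedSubgroup.whole S) fun _ _ => trivial
  refine ⟨ψ, hψ, fun u => ?_⟩
  rw [k]
  exact hg u (hmem u u.2)

/-- The morphisms of `F / N` are induced by morphisms of `F`. -/
theorem MorOn.exists_lift {N : F.OSC} {X : Subgroup N.Quot} {g : N.Quot → N.Quot}
    (hg : (F.quotient hF N).MorOn X g) :
    ∃ h, F.MorOn (X.comap N.quotientMk.toMonoidHom) h ∧
      ∀ u, N.quotientMk u ∈ X → g (N.quotientMk u) = N.quotientMk (h u) := by
  obtain ⟨hX, φ, ⟨ψ, hψ, k⟩, hφ⟩ := hg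
  obtain ⟨h, hh, k'⟩ := exists_morOn hψ
  refine ⟨h, hh, fun u hu => ?_⟩
  rw [← hφ _ hu, k' ⟨u, hu⟩]
  exact k ⟨u, hu⟩

/-- A morphism on `P` alone need not respect cosets of `N`; the extension to `PN` supplied by `hext`
does, and it has the same values modulo `N`. -/
theorem exists_quotient_morOn_map
    (hext : ∀ (N : F.OSC) {P : Subgroup S} {f : S → S}, F.MorOn P f →
      ∃ g, F.MorOn (P ⊔ N.toSubgroup) g ∧ ∀ u ∈ P, (f u)⁻¹ * g u ∈ N.toSubgroup)
    (N : F.OSC) {P : Subgroup S} {f : S → S} (hf : F.MorOn P f) :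
    ∃ g, (F.quotient hF N).MorOn (P.map N.quotientMk.toMonoidHom) g ∧
      ∀ u ∈ P, g (N.quotientMk u) = N.quotientMk (f u) := by
  obtain ⟨f', hf', hff'⟩ := hext N hf
  obtain ⟨g, hg, hgf⟩ := exists_quotient_morOn hF N hf' le_sup_right
  refine ⟨g, hg.mono (isClosed_discrete _) (Subgroup.map_mono le_sup_left), fun u hu => ?_⟩
  rw [hgf u (Subgroup.mem_sup_left hu)]
  exact (N.quotientMk_eq_iff.2 (hff' u hu)).symm

/-- A morphism of `F / N` lifts to `F` on the full preimage, and the lift passes to `F / M`. -/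
theorem isMorphism_quotMap
    (hext : ∀ (N : F.OSC) {P : Subgroup S} {f : S → S}, F.MorOn P f →
      ∃ g, F.MorOn (P ⊔ N.toSubgroup) g ∧ ∀ u ∈ P, (f u)⁻¹ * g u ∈ N.toSubgroup)
    (M N : F.OSC) (hMN : M ≤ N) :
    (F.quotient hF N).IsMorphism (F.quotient hF M) (OSC.quotMap hMN) := by
  refine isMorphism_iff.2 fun X g hg => ?_
  obtain ⟨h, hh, hhg⟩ := MorOn.exists_lift hF hg
  obtain ⟨g', hg', k⟩ := exists_quotient_morOn_map hF hext M hh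
  refine ⟨g', hg'.mono (isClosed_discrete _) ?_, fun x hx => ?_⟩
  · rintro _ ⟨x, hx, rfl⟩
    obtain ⟨u, rfl⟩ := N.quotientMk_surjective x
    exact ⟨u, hx, rfl⟩
  · obtain ⟨u, rfl⟩ := N.quotientMk_surjective x
    rw [hhg u hx]
    exact k u hx

/-- The natural map from `S` to the inverse limit of the groups `S / N`. -/
def toQuotientLimit (h : ∀ (M N : F.OSC) (hMN : M ≤ N),
      (F.quotient hF N).IsMorphism (F.quotient hF M) (OSC.quotMap hMN)) :
    S →ₜ* (F.quotientSystem hF h).LimitGroup where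
  toFun s := ⟨fun N => N.quotientMk s, fun _ _ _ => rfl⟩
  map_one' := rfl
  map_mul' _ _ := rfl
  continuous_toFun := Continuous.subtype_mk
    (continuous_pi fun N => N.quotientMk.continuous_toFun) _

/-- A point of the limit is a directed family of nonempty compact cosets, which have a common
element. -/
theorem toQuotientLimit_surjective (h : ∀ (M N : F.OSC) (hMN : M ≤ N),
      (F.quotient hF N).IsMorphism (F.quotient hF M) (OSC.quotMap hMN)) :
    Function.Surjective (toQuotientLimit hF h) := by
  rintro ⟨x, hx⟩
  have := OSC.nonempty (F := F)
  have hmono : ∀ M N : F.OSC, M ≤ N →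
      {s | N.quotientMk s = x N} ⊆ {s | M.quotientMk s = x M} := by
    intro M N hMN s hs
    have h1 : OSC.quotMap hMN (x N) = x M := hx M N hMN
    change M.quotientMk s = x M
    rw [← h1, ← show N.quotientMk s = x N from hs]
    rfl
  have hcl : ∀ N : F.OSC, IsClosed {s | N.quotientMk s = x N} := fun N =>
    isClosed_eq N.quotientMk.continuous_toFun continuous_const
  obtain ⟨s, hs⟩ := IsCompact.nonempty_iInter_of_directed_nonempty_isCompact_isClosed
    (fun N : F.OSC => {s | N.quotientMk s = x N})
    (fun M N => by
      obtain ⟨K, hMK, hNK⟩ := exists_ge_ge M N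
      exact ⟨K, hmono M K hMK, hmono N K hNK⟩)
    (fun N => N.quotientMk_surjective (x N)) (fun N => (hcl N).isCompact) hcl
  exact ⟨s, Subtype.ext (funext fun N => Set.mem_iInter.1 hs N)⟩

end Quotient

/-- The kernel of a projection, as an open strongly closed subgroup. -/
def Iso.kerProj {S : Type u} [Group S] [TopologicalSpace S] [CompactSpace S] [T2Space S]
    {F : FusionSystem S} {I : Type v} [PartialOrder I] {G : I → Type w}
    [∀ i, Group (G i)] [∀ i, TopologicalSpace (G i)] [∀ i, DiscreteTopology (G i)]
    [∀ i, Finite (G i)] {D : FusionInverseSystem I G} (e : F.Iso D.limit) (i : I) : F.OSC where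
  toSubgroup := (e.proj i).toMonoidHom.ker
  isOpen' := (isOpen_discrete {(1 : G i)}).preimage (e.proj i).continuous_toFun
  isStronglyClosed := (e.isMorphism_proj i).isStronglyClosed_ker

theorem Iso.proj_eq_of_quotientMk_kerProj {S : Type u} [Group S] [TopologicalSpace S]
    [IsTopologicalGroup S] [CompactSpace S] [T2Space S]
    {F : FusionSystem S} {I : Type v} [PartialOrder I] {G : I → Type w}
    [∀ i, Group (G i)] [∀ i, TopologicalSpace (G i)] [∀ i, DiscreteTopology (G i)]
    [∀ i, Finite (G i)] {D : FusionInverseSystem I G} (e : F.Iso D.limit) {i : I} {s t : S}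
    (h : (e.kerProj i).quotientMk s = (e.kerProj i).quotientMk t) : e.proj i s = e.proj i t := by
  have h1 : e.proj i (s⁻¹ * t) = 1 := (e.kerProj i).quotientMk_eq_iff.1 h
  rwa [map_mul, map_inv, inv_mul_eq_one] at h1

end FusionSystem

/-! ### The isomorphism of `F` with the limit of its quotients -/

theorem mainTheorem4 (p : ℕ) [Fact p.Prime] {S : Type u} [Group S] [TopologicalSpace S]
    [IsTopologicalGroup S] [CompactSpace S] [T2Space S] (F : FusionSystem S)
    (hF : FusionSystem.IsProSaturated.{u, v, w} p F) :
    (∀ N : F.OSC, IsPGroup p N.Quot) ∧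
    ∃ h : ∀ (M N : F.OSC) (hMN : M ≤ N),
        (F.quotient hF.isProFusion N).IsMorphism (F.quotient hF.isProFusion M)
          (FusionSystem.OSC.quotMap hMN),
      ∃ e : F.Iso (F.quotientSystem hF.isProFusion h).limit,
        ∀ (N : F.OSC) (s : S),
          (F.quotientSystem hF.isProFusion h).proj N (e.toEquiv s) = N.quotientMk s := by
  have hF' := hF.isProFusion
  obtain ⟨I, _, _, G, _, _, _, _, D, hp, hD, ⟨e⟩⟩ := hF
  -- From here on, saturation enters only through this property.
  have hext : ∀ (N : F.OSC) {P : Subgroup S} {f : S → S}, F.MorOn P f →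
      ∃ g, F.MorOn (P ⊔ N.toSubgroup) g ∧ ∀ u ∈ P, (f u)⁻¹ * g u ∈ N.toSubgroup :=
    fun N _ _ hf => e.exists_extension hp hD N.isStronglyClosed N.isOpen' hf
  have h : ∀ (M N : F.OSC) (hMN : M ≤ N), (F.quotient hF' N).IsMorphism (F.quotient hF' M)
      (FusionSystem.OSC.quotMap hMN) := FusionSystem.isMorphism_quotMap hF' hext
  refine ⟨fun N x => ?_, h, ?_⟩
  · obtain ⟨s, rfl⟩ := N.quotientMk_surjective x
    rcases isEmpty_or_nonempty I with hI | hI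
    · refine ⟨0, ?_⟩
      rw [e.proj_ext (s := s) (t := 1) fun i => (hI.false i).elim, map_one, one_pow]
    -- `S / N` is a quotient of `S / ker f_k`, which embeds in the `p`-group `G k`.
    · obtain ⟨k, hk⟩ := e.exists_ker_proj_le N.isOpen'
      obtain ⟨n, hn⟩ := hp k (e.proj k s)
      refine ⟨n, ?_⟩
      rw [← map_pow]
      refine (QuotientGroup.eq_one_iff _).2 (hk ?_)
      exact (map_pow (e.proj k) s _).trans hn
  let a := FusionSystem.toQuotientLimit hF' h
  have ha : Function.Bijective a := by
    refine ⟨fun s t hst => e.proj_ext fun i => e.proj_eq_of_quotientMk_kerProj ?_,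
      FusionSystem.toQuotientLimit_surjective hF' h⟩
    exact congrFun (congrArg Subtype.val hst) (e.kerProj i)
  let b : S ≃ₜ* (F.quotientSystem hF' h).LimitGroup :=
    { MulEquiv.ofBijective a ha with
      continuous_toFun := a.continuous_toFun
      continuous_invFun := Continuous.continuous_symm_of_equiv_compact_to_t2
        (f := (MulEquiv.ofBijective a ha).toEquiv) a.continuous_toFun }
  have hb : ∀ (N : F.OSC) s, (F.quotientSystem hF' h).proj N (b s) = N.quotientMk s :=
    fun _ _ => rfl
  refine ⟨⟨b, FusionSystem.isMorphism_iff.2 fun P f hf => ⟨fun x => b (f (b.symm x)), ?_, ?_⟩,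
    FusionSystem.isMorphism_iff.2 fun P f hf => ⟨fun x => b.symm (f (b x)), ?_, ?_⟩⟩, hb⟩
  · refine ((F.quotientSystem hF' h).limit_morOn_iff (ClosedSubgroup.image
      (b : S →ₜ* _) ⟨P, hf.isClosed⟩).isClosed').2 fun N => ?_
    obtain ⟨g, hg, hgf⟩ := FusionSystem.exists_quotient_morOn_map hF' hext N hf
    refine ⟨g, ?_, ?_⟩
    · refine hg.mono (isClosed_discrete _) ?_
      rintro _ ⟨_, ⟨x, hx, rfl⟩, rfl⟩
      exact ⟨x, hx, rfl⟩
    · rintro _ ⟨x, hx, rfl⟩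
      change g (N.quotientMk x) = N.quotientMk (f (b.symm (b x)))
      rw [b.symm_apply_apply]
      exact hgf x hx
  · exact fun x _ => congrArg (fun z => b (f z)) (b.symm_apply_apply x)
  · refine (e.morOn_iff_proj (ClosedSubgroup.image (b.symm : _ →ₜ* S)
      ⟨P, hf.isClosed⟩).isClosed').2 fun i => ?_
    -- At `N = ker f_i` the given morphism lifts to a morphism `k` of `F`, which induces `ψ` in the
    -- system at `i`. The lift agrees with the given map only modulo `ker f_i`, which `f_i` does not
    -- detect.
    obtain ⟨g, hg, hgf⟩ := ((F.quotientSystem hF' h).limit_morOn_iff hf.isClosed).1 hf (e.kerProj i)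
    obtain ⟨k, hk, hkg⟩ := FusionSystem.MorOn.exists_lift hF' hg
    obtain ⟨ψ, hψ, hψk⟩ := (e.morOn_iff_proj hk.isClosed).1 hk i
    have hP : ∀ x ∈ P, (e.kerProj i).quotientMk (b.symm x) ∈
        P.map ((F.quotientSystem hF' h).proj (e.kerProj i)).toMonoidHom := fun x hx => by
      refine ⟨x, hx, ?_⟩
      rw [← hb, b.apply_symm_apply]
      rfl
    refine ⟨ψ, hψ.mono (isClosed_discrete _) (Subgroup.map_mono ?_), ?_⟩
    · rintro _ ⟨x, hx, rfl⟩
      exact hP x hx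
    · rintro _ ⟨x, hx, rfl⟩
      refine (hψk _ (hP x hx)).trans (e.proj_eq_of_quotientMk_kerProj ?_)
      refine (hkg _ (hP x hx)).symm.trans ?_
      change g _ = (e.kerProj i).quotientMk (b.symm (f (b (b.symm x))))
      rw [← hb, ← hb, b.apply_symm_apply, b.apply_symm_apply]
      exact hgf x hx
  · exact fun x _ => congrArg (fun z => b.symm (f z)) (b.apply_symm_apply x)
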